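/- \textbf{Theorem 1.} Let $\mathbf{A}\in\mathbb{R}^{m\times n}$ have columns $\mathbf{a}_1,\dots,\mathbf{a}_n$ of unit $\ell_2$-norm. Let $\mathbf{X}\in\mathbb{R}^{n\times r}$ have at most $K$ nonzero rows and linearly independent columns, and suppose that any $r$ nonzero rows of $\mathbf{X}$ are linearly independent. Let $S$ be the support of $\mathbf{X}$ (the index set of its nonzero rows), let $\mathbf{Y}=\mathbf{A}\mathbf{X}$, and let $1\le L\le\min\{K,\frac mK\}$. \emph{Notation.} For $J\subseteq\Omega=\{1,\dots,n\}$, $\mathbf{A}_J$ is the submatrix of columns indexed by $J$, $\mathbf{X}^J$ denotes the rows of $\mathbf X$ indexed by $J$ (all other rows being read as $0$ in differences), $\mathcal{R}(\cdot)$ is the column space, $\mathbf{P}_{\mathcal V}$ is the orthogonal projection onto $\mathcal V$, $\mathbf{P}_J=\mathbf{P}_{\mathcal{R}(\mathbf{A}_J)}$ and $\mathbf{P}_J^\perp=\mathbf{I}-\mathbf{P}_J$. The subspace distance is $\operatorname{dist}(\mathcal V,\mathcal W)=\sqrt{\max\{p,q\}-\sum_{i=1}^p\sum_{j=1}^q|\langle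 \mathbf v_i,\mathbf w_j\rangle|^2}$ for orthonormal bases $(\mathbf v_i)_{i\le p}$ of $\mathcal V$ and $(\mathbf w_j)_{j\le q}$ of $\mathcal W$. $\operatorname{krank}(\mathbf A)$ is the largest $k \le n$ such that any $k$ columns of $\mathbf A$ are linearly independent. $\mathbf A$ has the restricted isometry property (RIP) of order $s$ if there is $\delta\in(0,1)$ with $(1-\delta)\|\mathbf x\|_2^2\le\|\mathbf A\mathbf x\|_2^2\le(1+\delta)\|\mathbf x\|_2^2$ for all $\mathbf x\in\mathbb R^n$ with at most $s$ nonzero entries; $\delta_s$ is the least $\delta\ge0$ satisfying these inequalities. \emph{The SSMP algorithm} (noiseless, stopping threshold $0$). Start with $k=0$, $S^0=\emptyset$, $\mathbf R^0=\mathbf Y$. While $k<\min\{K,\lfloor\frac mL\rfloor\}$ and $\operatorname{dist}(\mathcal R(\mathbf Y),\mathbf P_{S^k}\mathcal R(\mathbf Y))>0$: choose $L$ indices $i\in\Omega\setminus S^k$ (all of them if fewer than $L$ remain) with the largest values of $\|\mathbf P_{\mathcal R(\mathbf R^k)}\mathbf b_i\|_2$, where $\mathbf b_i=\mathbf P_{S^k}^\perp\mathbf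 a_i/\|\mathbf P_{S^k}^\perp\mathbf a_i\|_2$ ($\mathbf b_i=\mathbf 0$ if $\mathbf P_{S^k}^\perp\mathbf a_i=\mathbf 0$), ties being broken arbitrarily; add them to $S^k$ to obtain $S^{k+1}$; let $\mathbf X^{k+1}$ be a minimizer of $\|\mathbf Y-\mathbf A\mathbf U\|_F$ over all $\mathbf U$ with support in $S^{k+1}$, put $\mathbf R^{k+1}=\mathbf Y-\mathbf A\mathbf X^{k+1}$, and increase $k$ by one. When the loop has stopped after $k$ iterations, choose $\widehat S$ minimizing $\|\mathbf X^k-(\mathbf X^k)^J\|_F$ over $|J|=K$, and output $\widehat{\mathbf X}$ with rows $\widehat{\mathbf X}^{\widehat S}=\mathbf A_{\widehat S}^\dagger\mathbf Y$, where $\mathbf A_{\widehat S}^\dagger=(\mathbf A_{\widehat S}'\mathbf A_{\widehat S})^{-1}\mathbf A_{\widehat S}'$, and zero rows outside $\widehat S$. (If $k=0$, $\mathbf X^0=\mathbf 0$.) \emph{Claim.} Assume one of the following conditions: (i) $r=K$ and $\operatorname{krank}(\mathbf A)\ge K+1$; (ii) $r<K$ and $\mathbf A$ has the RIP of order $L(K-r)+r+1$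 with $$\delta_{L(K-r)+r+1}<\max\left\{\frac{\sqrt r}{\sqrt{K+\frac r4}+\sqrt{\frac r4}},\ \frac{\sqrt L}{\sqrt K+1.15\sqrt L}\right\}.$$ Then SSMP can be executed, and however ties are broken and least-squares minimizers are chosen, it stops after some number $k\le K-r+\lceil\frac rL\rceil$ of iterations with $S\subseteq S^k$. Moreover it recovers $\mathbf X$ exactly, that is, $\mathbf X^k=\mathbf X$ and $\widehat{\mathbf X}=\mathbf X$, provided that the final least-squares problem is well posed, i.e. $\mathbf A_{S^k}$ has full column rank; this proviso is not needed if $L\lceil\frac rL\rceil\le r+1$ (in particular if $L\le2$). -/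

import Mathlib

/-- The `j`-th column of a real matrix, as a vector of Euclidean space. -/
def euclCol {m n : ℕ} (H : Matrix (Fin m) (Fin n) ℝ) (j : Fin n) : EuclideanSpace ℝ (Fin m) :=
  WithLp.toLp 2 (fun i => H i j)

/-- `R(H_J)`: the span of the columns of `H` indexed by `J`. -/
def colSpaceOn {m n : ℕ} (H : Matrix (Fin m) (Fin n) ℝ) (J : Finset (Fin n)) :
    Submodule ℝ (EuclideanSpace ℝ (Fin m)) :=
  Submodule.span ℝ (euclCol H '' (J : Set (Fin n)))

/-- `R(H)`: the column space of `H`. -/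
def colSpace {m n : ℕ} (H : Matrix (Fin m) (Fin n) ℝ) :
    Submodule ℝ (EuclideanSpace ℝ (Fin m)) :=
  Submodule.span ℝ (Set.range (euclCol H))

/-- The columns of `H` indexed by `J` are linearly independent (`H_J` has full column rank). -/
def FullColumnRankOn {m n : ℕ} (H : Matrix (Fin m) (Fin n) ℝ) (J : Finset (Fin n)) : Prop :=
  LinearIndependent ℝ (fun j : J => euclCol H (j : Fin n))

/-- The Kruskal rank: the largest `k ≤ n` such that any `k` columns are linearly independent. -/
noncomputable def krank {m n : ℕ} (H : Matrix (Fin m) (Fin n) ℝ) : ℕ :=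
  sSup {k : ℕ | k ≤ n ∧ ∀ J : Finset (Fin n), J.card = k → FullColumnRankOn H J}

/-- The support of a matrix: the index set of its nonzero rows. -/
noncomputable def rowSupport {n r : ℕ} (X : Matrix (Fin n) (Fin r) ℝ) : Finset (Fin n) :=
  open Classical in Finset.univ.filter (fun i => X i ≠ 0)

/-- Any `r` nonzero rows of `X` are linearly independent. -/
def AnyNonzeroRowsIndep {n : ℕ} (r : ℕ) (X : Matrix (Fin n) (Fin r) ℝ) : Prop :=
  ∀ J : Finset (Fin n), J ⊆ rowSupport X → J.card = r →
    LinearIndependent ℝ (fun i : J => X (i : Fin n))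

/-- The Frobenius norm. -/
noncomputable def frobNorm {m n : ℕ} (H : Matrix (Fin m) (Fin n) ℝ) : ℝ :=
  Real.sqrt (∑ i, ∑ j, H i j ^ 2)

/-- The two-sided restricted isometry inequality with constant `δ` for all `s`-sparse vectors. -/
def RIPBound {m n : ℕ} (A : Matrix (Fin m) (Fin n) ℝ) (s : ℕ) (δ : ℝ) : Prop :=
  ∀ x : EuclideanSpace ℝ (Fin n), (Finset.univ.filter (fun i => x i ≠ 0)).card ≤ s →
    (1 - δ) * ‖x‖ ^ 2 ≤ ‖(WithLp.toLp 2 (A.mulVec x.ofLp) : EuclideanSpace ℝ (Fin m))‖ ^ 2 ∧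
    ‖(WithLp.toLp 2 (A.mulVec x.ofLp) : EuclideanSpace ℝ (Fin m))‖ ^ 2 ≤ (1 + δ) * ‖x‖ ^ 2

/-- The restricted isometry property of order `s`. -/
def HasRIP {m n : ℕ} (A : Matrix (Fin m) (Fin n) ℝ) (s : ℕ) : Prop :=
  ∃ δ : ℝ, 0 < δ ∧ δ < 1 ∧ RIPBound A s δ

/-- The restricted isometry constant `δ_s`: the least `δ ≥ 0` in the restricted isometry
inequality of order `s`. -/
noncomputable def ripConst {m n : ℕ} (A : Matrix (Fin m) (Fin n) ℝ) (s : ℕ) : ℝ :=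
  sInf {δ : ℝ | 0 ≤ δ ∧ RIPBound A s δ}

/-- The subspace distance `√(max{p, q} - ∑ᵢ ∑ⱼ |⟨vᵢ, wⱼ⟩|²)`, for orthonormal bases `(vᵢ)`, `(wⱼ)`
of `V`, `W`; its value does not depend on which orthonormal bases are taken. -/
noncomputable def subspaceDist {m : ℕ} (V W : Submodule ℝ (EuclideanSpace ℝ (Fin m))) : ℝ :=
  Real.sqrt (max (Module.finrank ℝ V : ℝ) (Module.finrank ℝ W : ℝ) -
    ∑ i, ∑ j, |inner ℝ (stdOrthonormalBasis ℝ V i : EuclideanSpace ℝ (Fin m))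
      (stdOrthonormalBasis ℝ W j : EuclideanSpace ℝ (Fin m))| ^ 2)

namespace SSMP

/-- The column `bᵢ = P_S^⊥ aᵢ / ‖P_S^⊥ aᵢ‖` of the normalized counterpart of `P_S^⊥ A`. It is `0`
where `P_S^⊥ aᵢ = 0`, in particular for `i ∈ S`. -/
noncomputable def normalizedCol {m n : ℕ} (A : Matrix (Fin m) (Fin n) ℝ) (S : Finset (Fin n))
    (i : Fin n) : EuclideanSpace ℝ (Fin m) :=
  ‖(colSpaceOn A S)ᗮ.starProjection (euclCol A i)‖⁻¹ •
    (colSpaceOn A S)ᗮ.starProjection (euclCol A i)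

/-- The score `‖P_{R(R)} bᵢ‖` of the index `i`. -/
noncomputable def score {m n r : ℕ} (A : Matrix (Fin m) (Fin n) ℝ) (R : Matrix (Fin m) (Fin r) ℝ)
    (S : Finset (Fin n)) (i : Fin n) : ℝ :=
  ‖(colSpace R).starProjection (normalizedCol A S i)‖

/-- `I` consists of `L` indices outside `S` with largest scores (ties are broken arbitrarily;
all remaining indices are taken if fewer than `L` of them are left). -/
def IsSelected {m n r : ℕ} (A : Matrix (Fin m) (Fin n) ℝ) (R : Matrix (Fin m) (Fin r) ℝ)
    (S : Finset (Fin n)) (L : ℕ) (I : Finset (Fin n)) : Prop :=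
  Disjoint I S ∧ I.card = min L (Finset.univ \ S).card ∧
    ∀ i ∈ I, ∀ j, j ∉ S → j ∉ I → score A R S j ≤ score A R S i

/-- `X` minimizes `‖Y - A U‖_F` over all `U` whose row support lies in `S`. -/
def IsLeastSquares {m n r : ℕ} (A : Matrix (Fin m) (Fin n) ℝ) (Y : Matrix (Fin m) (Fin r) ℝ)
    (S : Finset (Fin n)) (X : Matrix (Fin n) (Fin r) ℝ) : Prop :=
  rowSupport X ⊆ S ∧
    ∀ U : Matrix (Fin n) (Fin r) ℝ, rowSupport U ⊆ S → frobNorm (Y - A * X) ≤ frobNorm (Y - A * U)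

/-- The condition of the while loop, at the iteration counter `k` and the estimated support `S`. -/
def LoopCondition {m n r : ℕ} (A : Matrix (Fin m) (Fin n) ℝ) (Y : Matrix (Fin m) (Fin r) ℝ)
    (K L : ℕ) (ε : ℝ) (k : ℕ) (S : Finset (Fin n)) : Prop :=
  k < min K (m / L) ∧
    ε < subspaceDist (colSpace Y)
      ((colSpace Y).map ((colSpaceOn A S).starProjection : _ →ₗ[ℝ] _))

/-- A complete execution of the loop of the SSMP algorithm, which stops after `iters` iterations;
the values of `supp` and `est` beyond `iters` are irrelevant. The residual of the `k`-th iteration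
is `Y - A * est k`. For `k = 0` the support is empty, so `est 0 = 0` and the residual is `Y`. -/
structure Run {m n r : ℕ} (A : Matrix (Fin m) (Fin n) ℝ) (Y : Matrix (Fin m) (Fin r) ℝ)
    (K L : ℕ) (ε : ℝ) where
  /-- the number of iterations performed -/
  iters : ℕ
  /-- the estimated supports -/
  supp : ℕ → Finset (Fin n)
  /-- the estimates of the signal -/
  est : ℕ → Matrix (Fin n) (Fin r) ℝ
  supp_zero : supp 0 = ∅
  selects : ∀ k < iters, ∃ I : Finset (Fin n),
    IsSelected A (Y - A * est k) (supp k) L I ∧ supp (k + 1) = supp k ∪ I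
  estimates : ∀ k ≤ iters, IsLeastSquares A Y (supp k) (est k)
  continues : ∀ k < iters, LoopCondition A Y K L ε k (supp k)
  stops : ¬ LoopCondition A Y K L ε iters (supp iters)

/-- The matrix that agrees with `X` on the rows indexed by `J` and vanishes on the others. -/
def restrictRows {n r : ℕ} (X : Matrix (Fin n) (Fin r) ℝ) (J : Finset (Fin n)) :
    Matrix (Fin n) (Fin r) ℝ :=
  fun i => if i ∈ J then X i else 0

/-- `J` is a pruned support: it minimizes `‖X - X^J‖_F` over all index sets with `K` elements. -/
def IsPruned {n r : ℕ} (K : ℕ) (X : Matrix (Fin n) (Fin r) ℝ) (J : Finset (Fin n)) : Prop :=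
  J.card = K ∧ ∀ J' : Finset (Fin n), J'.card = K →
    frobNorm (X - restrictRows X J) ≤ frobNorm (X - restrictRows X J')

/-- The output for the pruned support `J`: its rows indexed by `J` are those of
`A_J^† Y = (A_J' A_J)⁻¹ A_J' Y`, the others are zero. -/
noncomputable def output {m n r : ℕ} (A : Matrix (Fin m) (Fin n) ℝ) (Y : Matrix (Fin m) (Fin r) ℝ)
    (J : Finset (Fin n)) : Matrix (Fin n) (Fin r) ℝ :=
  let AJ : Matrix (Fin m) J ℝ := A.submatrix id (fun j : J => (j : Fin n))
  fun i => if h : i ∈ J then ((AJ.transpose * AJ)⁻¹ * AJ.transpose * Y) ⟨i, h⟩ else 0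

end SSMP

/-! Let `T` be the current support estimate and `Q` the set of support indices still missing. Least
squares makes the residual equal to `P_T^⊥ A X`, so its column space `R` consists of combinations of
the projected columns `P_T^⊥ a_q` with `q ∈ Q`. The proof splits according to whether `|Q|` exceeds
`r`.

If `|Q| > r`, then `dim R = r`, and at least one selected index is correct
(`IsSelected.not_disjoint_rowSupport`). Restricted isometry survives projecting out `T`. Under the
first threshold, the squared scores over `Q` sum to at least `r(1 - δ)`, while each index outside `Q
∪ T` has squared score at most `δ²`. Under the second, for each unit vector of an orthonormal basis
of `R`, its squared correlations with `L` wrong columns are compared with those over `Q`.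

If `|Q| ≤ r`, independence of any `r` nonzero rows makes `R` the whole span of the projected missing
columns. Missing indices then have score exactly 1, and all others score below 1 by linear
independence. Every choice is therefore correct until nothing is missing
(`IsSelected.subset_or_subset`). Under condition (i) only this phase occurs, so the Kruskal rank
suffices.

Thus at most `K - r` iterations bring the missing count down to `r`, and each later one removes `L`
indices or all that remain. `Run.card_le` records this with truncated subtraction. Zero distance at
the stop forces the support to be contained in the estimate, and full column rank then gives exact
recovery. -/

section RestrictedIsometry

/-! ### Restricted isometry for families of vectors. -/

variable {ι E : Type*} [NormedAddCommGroup E] [InnerProductSpace ℝ E]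

/-- The restricted isometry inequalities with constant `δ` for the family `a` on the index set
`J`. -/
def RestrictedIsometryOn (a : ι → E) (J : Finset ι) (δ : ℝ) : Prop :=
  ∀ x : ι → ℝ, (1 - δ) * ∑ i ∈ J, x i ^ 2 ≤ ‖∑ i ∈ J, x i • a i‖ ^ 2 ∧
    ‖∑ i ∈ J, x i • a i‖ ^ 2 ≤ (1 + δ) * ∑ i ∈ J, x i ^ 2

/-- The components of the vectors `a i` orthogonal to the span of those indexed by `T`. -/
noncomputable def projectOut [FiniteDimensional ℝ E] (a : ι → E) (T : Finset ι) (i : ι) : E :=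
  (Submodule.span ℝ (a '' (T : Set ι)))ᗮ.starProjection (a i)

theorem exists_sum_eq_of_mem_span_image {a : ι → E} {J : Finset ι} {v : E}
    (hv : v ∈ Submodule.span ℝ (a '' (J : Set ι))) : ∃ z : ι → ℝ, ∑ i ∈ J, z i • a i = v := by
  classical
  obtain ⟨c, hc⟩ := (Submodule.mem_span_image_finset_iff_exists_fun ℝ).1 hv
  refine ⟨fun i => if h : i ∈ J then c ⟨i, h⟩ else 0, ?_⟩
  rw [← hc, ← Finset.sum_coe_sort J]
  exact Finset.sum_congr rfl fun i _ => by simp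

theorem sum_smul_mem_span_image (a : ι → E) {I J : Finset ι} (h : I ⊆ J) (z : ι → ℝ) :
    ∑ i ∈ I, z i • a i ∈ Submodule.span ℝ (a '' (J : Set ι)) :=
  Submodule.sum_mem _ fun i hi => Submodule.smul_mem _ _ (Submodule.subset_span ⟨i, h hi, rfl⟩)

theorem sum_union_ite_smul [DecidableEq ι] {M : Type*} [AddCommMonoid M] [Module ℝ M]
    (a : ι → M) {I J : Finset ι} (h : Disjoint I J) (x y : ι → ℝ) :
    ∑ i ∈ I ∪ J, (if i ∈ I then x i else y i) • a i = ∑ i ∈ I, x i • a i + ∑ i ∈ J, y i • a i := by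
  rw [Finset.sum_union h]
  congr 1
  · exact Finset.sum_congr rfl fun i hi => by rw [if_pos hi]
  · exact Finset.sum_congr rfl fun i hi => by rw [if_neg (Finset.disjoint_right.1 h hi)]

theorem sum_union_ite_sq [DecidableEq ι] {I J : Finset ι} (h : Disjoint I J) (x y : ι → ℝ) :
    ∑ i ∈ I ∪ J, (if i ∈ I then x i else y i) ^ 2 = ∑ i ∈ I, x i ^ 2 + ∑ i ∈ J, y i ^ 2 := by
  rw [Finset.sum_union h]
  congr 1
  · exact Finset.sum_congr rfl fun i hi => by rw [if_pos hi]
  · exact Finset.sum_congr rfl fun i hi => by rw [if_neg (Finset.disjoint_right.1 h hi)]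

theorem norm_sub_starProjection_sq_le [FiniteDimensional ℝ E] (W : Submodule ℝ E) (v w : E)
    (hw : w ∈ W) : ‖v - W.starProjection v‖ ^ 2 ≤ ‖v - w‖ ^ 2 := by
  have h : inner ℝ (v - W.starProjection v) (W.starProjection v - w) = (0 : ℝ) :=
    Submodule.starProjection_inner_eq_zero _ _ (W.sub_mem (W.starProjection_apply_mem v) hw)
  have h2 : v - w = (v - W.starProjection v) + (W.starProjection v - w) := by abel
  rw [h2, norm_add_sq_real, h]
  nlinarith [sq_nonneg ‖W.starProjection v - w‖]

namespace RestrictedIsometryOn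

variable {a : ι → E} {I J Q T : Finset ι} {δ : ℝ}

theorem subset [DecidableEq ι] (h : RestrictedIsometryOn a J δ) (hIJ : I ⊆ J) :
    RestrictedIsometryOn a I δ := by
  intro x
  have h1 := h (fun i => if i ∈ I then x i else 0)
  have e1 : ∑ i ∈ J, (if i ∈ I then x i else 0) ^ 2 = ∑ i ∈ I, x i ^ 2 := by
    rw [← Finset.sum_subset hIJ fun i _ hi => by simp [hi]]
    exact Finset.sum_congr rfl fun i hi => by rw [if_pos hi]
  have e2 : ∑ i ∈ J, (if i ∈ I then x i else 0) • a i = ∑ i ∈ I, x i • a i := by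
    rw [← Finset.sum_subset hIJ fun i _ hi => by simp [hi]]
    exact Finset.sum_congr rfl fun i hi => by rw [if_pos hi]
  simpa only [e1, e2] using h1

/-- The projected combination is itself a combination over `Q ∪ T`, with extra coefficients on `T`
that only help the lower bound. The upper bound holds because projection does not increase norms. -/
theorem projectOut [DecidableEq ι] [FiniteDimensional ℝ E] (h : RestrictedIsometryOn a (Q ∪ T) δ)
    (hδ : δ ≤ 1) (hQT : Disjoint Q T) : RestrictedIsometryOn (projectOut a T) Q δ := by
  intro x
  set W := Submodule.span ℝ (a '' (T : Set ι)) with hW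
  set v := ∑ i ∈ Q, x i • a i with hv
  have e : ∑ i ∈ Q, x i • _root_.projectOut a T i = v - W.starProjection v := by
    rw [← Submodule.starProjection_orthogonal_val, hv, map_sum]
    exact Finset.sum_congr rfl fun i _ => by rw [map_smul]; rfl
  rw [e]
  constructor
  · obtain ⟨z, hz⟩ := exists_sum_eq_of_mem_span_image (W.starProjection_apply_mem v)
    have h1 := (h (fun i => if i ∈ Q then x i else - z i)).1
    rw [sum_union_ite_smul a hQT x (fun i => - z i), sum_union_ite_sq hQT x (fun i => - z i)] at h1
    simp only [neg_smul, Finset.sum_neg_distrib, hz, neg_sq] at h1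
    rw [← sub_eq_add_neg] at h1
    have : 0 ≤ (1 - δ) * ∑ i ∈ T, z i ^ 2 :=
      mul_nonneg (by linarith) (Finset.sum_nonneg fun i _ => sq_nonneg _)
    linarith
  · have h1 := norm_sub_starProjection_sq_le W v 0 W.zero_mem
    rw [sub_zero] at h1
    exact h1.trans ((h.subset Finset.subset_union_left) x).2

theorem sum_smul_eq_zero (h : RestrictedIsometryOn a J δ) (hδ : δ < 1) {x : ι → ℝ}
    (hx : ∑ i ∈ J, x i • a i = 0) {i : ι} (hi : i ∈ J) : x i = 0 := by
  have h1 := (h x).1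
  rw [hx, norm_zero] at h1
  have h2 : x i ^ 2 ≤ ∑ i ∈ J, x i ^ 2 :=
    Finset.single_le_sum (f := fun i => x i ^ 2) (fun i _ => sq_nonneg _) hi
  have h3 : x i ^ 2 ≤ 0 := by nlinarith
  exact pow_eq_zero_iff two_ne_zero |>.1 (le_antisymm h3 (sq_nonneg _))

/-- Polarization: subtract the lower bound at `(x, -y)` from the upper bound at `(x, y)`. -/
theorem two_mul_inner_le [DecidableEq ι] (h : RestrictedIsometryOn a (Q ∪ I) δ)
    (hQI : Disjoint Q I) (x y : ι → ℝ) :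
    2 * inner ℝ (∑ i ∈ Q, x i • a i) (∑ i ∈ I, y i • a i) ≤
      δ * (∑ i ∈ Q, x i ^ 2 + ∑ i ∈ I, y i ^ 2) := by
  have h1 := (h (fun i => if i ∈ Q then x i else y i)).2
  have h2 := (h (fun i => if i ∈ Q then x i else - y i)).1
  rw [sum_union_ite_smul a hQI x y, sum_union_ite_sq hQI x y] at h1
  rw [sum_union_ite_smul a hQI x (fun i => - y i), sum_union_ite_sq hQI x (fun i => - y i)] at h2
  simp only [neg_smul, Finset.sum_neg_distrib, neg_sq] at h2
  rw [← sub_eq_add_neg, norm_sub_sq_real] at h2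
  rw [norm_add_sq_real] at h1
  linarith

/-- The off-diagonal blocks of the Gram matrix have norm at most `δ`. -/
theorem sum_inner_sq_le [DecidableEq ι] (h : RestrictedIsometryOn a (Q ∪ I) δ) (hδ : 0 < δ)
    (hQI : Disjoint Q I) (x : ι → ℝ) :
    ∑ i ∈ I, inner ℝ (a i) (∑ q ∈ Q, x q • a q) ^ 2 ≤ δ ^ 2 * ∑ q ∈ Q, x q ^ 2 := by
  set u := ∑ q ∈ Q, x q • a q with hu
  -- Testing against the correlations themselves bounds their norm by duality; the scale `δ⁻¹` makes
  -- the constant exactly `δ²`.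
  have h1 := h.two_mul_inner_le hQI x (fun i => δ⁻¹ * inner ℝ (a i) u)
  rw [← hu] at h1
  have e1 : inner ℝ u (∑ i ∈ I, (δ⁻¹ * inner ℝ (a i) u) • a i) =
      δ⁻¹ * ∑ i ∈ I, inner ℝ (a i) u ^ 2 := by
    rw [inner_sum, Finset.mul_sum]
    refine Finset.sum_congr rfl fun i _ => ?_
    rw [inner_smul_right, real_inner_comm]
    ring
  have e2 : ∑ i ∈ I, (δ⁻¹ * inner ℝ (a i) u) ^ 2 = (δ⁻¹) ^ 2 * ∑ i ∈ I, inner ℝ (a i) u ^ 2 := by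
    rw [Finset.mul_sum]
    exact Finset.sum_congr rfl fun i _ => by ring
  rw [e1, e2] at h1
  have h2 := mul_le_mul_of_nonneg_left h1 hδ.le
  field_simp at h2
  linarith

/-- A unit vector outside an index set has a projection of norm at most `δ` on the span of the
vectors in the index set. -/
theorem one_sub_sq_le [DecidableEq ι] [FiniteDimensional ℝ E] {j : ι}
    (h : RestrictedIsometryOn a (insert j J) δ) (hδ : 0 < δ) (hδ1 : δ < 1) (hj : j ∉ J)
    (ha : ‖a j‖ = 1) :
    1 - δ ^ 2 ≤ ‖a j - (Submodule.span ℝ (a '' (J : Set ι))).starProjection (a j)‖ ^ 2 := by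
  set W := Submodule.span ℝ (a '' (J : Set ι)) with hW
  set v := W.starProjection (a j) with hv
  obtain ⟨z, hz⟩ := exists_sum_eq_of_mem_span_image (W.starProjection_apply_mem (a j))
  rw [← hv] at hz
  have hin : inner ℝ (a j - v) v = (0 : ℝ) :=
    Submodule.starProjection_inner_eq_zero _ _ (W.starProjection_apply_mem _)
  have hin2 : inner ℝ (a j) v = ‖v‖ ^ 2 := by
    rw [inner_sub_left, real_inner_self_eq_norm_sq] at hin
    linarith
  have hd : Disjoint {j} J := by simpa using hj
  have hJ : insert j J = {j} ∪ J := rfl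
  rw [hJ] at h
  have key : ∀ t : ℝ, (1 - δ) * (1 + t ^ 2 * ∑ i ∈ J, z i ^ 2) ≤ ‖a j + t • v‖ ^ 2 ∧
      ‖a j + t • v‖ ^ 2 ≤ (1 + δ) * (1 + t ^ 2 * ∑ i ∈ J, z i ^ 2) := by
    intro t
    have h1 := h (fun i => if i ∈ ({j} : Finset ι) then 1 else t * z i)
    rw [sum_union_ite_smul a hd (fun _ => 1) (fun i => t * z i),
      sum_union_ite_sq hd (fun _ => 1) (fun i => t * z i)] at h1
    simpa only [Finset.sum_singleton, one_smul, mul_smul, ← Finset.smul_sum, hz, one_pow, mul_pow,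
      ← Finset.mul_sum] using h1
  -- Weighting these two bounds by `1 + δ` and `1 - δ` gives both the same coefficient sum times `1
  -- - δ²`, so the unknown `∑ z i ^ 2` cancels. With `t = ±δ⁻¹` what remains is `‖v‖² ≤ δ²`.
  have k1 := (key (-δ⁻¹)).1
  have k2 := (key δ⁻¹).2
  rw [norm_add_sq_real, inner_smul_right, norm_smul, hin2, ha, mul_pow, Real.norm_eq_abs, sq_abs]
    at k1 k2
  rw [norm_sub_sq_real, hin2, ha]
  have m1 := mul_le_mul_of_nonneg_left k1 (by linarith : (0 : ℝ) ≤ 1 + δ)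
  have m2 := mul_le_mul_of_nonneg_left k2 (by linarith : (0 : ℝ) ≤ 1 - δ)
  have e : δ⁻¹ ^ 2 = δ⁻¹ * δ⁻¹ := sq _
  have e1 : δ * δ⁻¹ = 1 := mul_inv_cancel₀ hδ.ne'
  rw [neg_sq] at m1
  have m3 : 0 ≤ 2 * δ - 4 * (δ⁻¹ * ‖v‖ ^ 2) + 2 * δ * (δ⁻¹ ^ 2 * ‖v‖ ^ 2) := by nlinarith
  have e3 : δ * (2 * δ - 4 * (δ⁻¹ * ‖v‖ ^ 2) + 2 * δ * (δ⁻¹ ^ 2 * ‖v‖ ^ 2)) =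
      2 * δ ^ 2 - 2 * ‖v‖ ^ 2 := by field_simp; ring
  have m4 := mul_nonneg hδ.le m3
  rw [e3] at m4
  nlinarith

/-- Expand one factor of `‖u‖²`, apply Cauchy–Schwarz, and bound the coefficients by `‖u‖² / (1 -
δ)`. -/
theorem mul_norm_sq_le_sum_inner_sq (h : RestrictedIsometryOn a Q δ) (hδ1 : δ < 1) (x : ι → ℝ) :
    (1 - δ) * ‖∑ q ∈ Q, x q • a q‖ ^ 2 ≤ ∑ q ∈ Q, inner ℝ (a q) (∑ q ∈ Q, x q • a q) ^ 2 := by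
  set u := ∑ q ∈ Q, x q • a q with hu
  have e : ‖u‖ ^ 2 = ∑ q ∈ Q, x q * inner ℝ (a q) u := by
    rw [← real_inner_self_eq_norm_sq]
    nth_rewrite 1 [hu]
    rw [sum_inner]
    exact Finset.sum_congr rfl fun i _ => by rw [real_inner_smul_left]
  have cs := Finset.sum_mul_sq_le_sq_mul_sq Q x (fun q => inner ℝ (a q) u)
  rw [← e] at cs
  have h1 := (h x).1
  rw [← hu] at h1
  have hS : 0 ≤ ∑ q ∈ Q, inner ℝ (a q) u ^ 2 := Finset.sum_nonneg fun i _ => sq_nonneg _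
  rcases (sq_nonneg ‖u‖).eq_or_lt with h0 | h0
  · rw [← h0]; simpa using hS
  · refine le_of_mul_le_mul_left ?_ h0
    nlinarith [mul_le_mul_of_nonneg_right h1 hS,
      mul_le_mul_of_nonneg_left cs (by linarith : (0 : ℝ) ≤ 1 - δ)]

end RestrictedIsometryOn

end RestrictedIsometry

/-! ### Bounds on the scores of missing and of wrong indices. -/

section Scores

variable {ι E : Type*} [NormedAddCommGroup E] [InnerProductSpace ℝ E]

theorem inner_sq_le_inner_normalize_sq {v : E} (hv : ‖v‖ ≤ 1) (u : E) :
    inner ℝ v u ^ 2 ≤ inner ℝ (‖v‖⁻¹ • v) u ^ 2 := by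
  rcases eq_or_ne v 0 with rfl | h
  · simp
  · rw [real_inner_smul_left, mul_pow]
    have h1 : 1 ≤ ‖v‖⁻¹ := one_le_inv_iff₀.2 ⟨norm_pos_iff.2 h, hv⟩
    exact le_mul_of_one_le_left (sq_nonneg _) (one_le_pow₀ h1)

theorem inner_normalize_sq_le {v : E} {c : ℝ} (hc : 0 < c) (hv : c ≤ ‖v‖ ^ 2) (u : E) :
    inner ℝ (‖v‖⁻¹ • v) u ^ 2 ≤ c⁻¹ * inner ℝ v u ^ 2 := by
  rw [real_inner_smul_left, mul_pow, inv_pow]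
  exact mul_le_mul_of_nonneg_right (inv_anti₀ hc hv) (sq_nonneg _)

variable [FiniteDimensional ℝ E]

/-- This reduces sums of squared scores to estimates for one unit vector of `R` at a time. -/
theorem norm_starProjection_sq_eq_sum (R : Submodule ℝ E) (v : E) :
    ‖R.starProjection v‖ ^ 2 = ∑ i, inner ℝ (stdOrthonormalBasis ℝ R i : E) v ^ 2 := by
  have h := (stdOrthonormalBasis ℝ R).sum_sq_norm_inner_right
    ⟨R.starProjection v, R.starProjection_apply_mem v⟩
  rw [Submodule.coe_norm] at h
  rw [← h]
  refine Finset.sum_congr rfl fun i _ => ?_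
  rw [Real.norm_eq_abs, sq_abs, Submodule.coe_inner]
  change inner ℝ (stdOrthonormalBasis ℝ R i : E) (R.starProjection v) ^ 2 = _
  rw [← Submodule.inner_starProjection_left_eq_right,
    Submodule.starProjection_eq_self_iff.2 (stdOrthonormalBasis ℝ R i).2]

theorem projectOut_eq_sub (a : ι → E) (T : Finset ι) (i : ι) :
    projectOut a T i = a i - (Submodule.span ℝ (a '' (T : Set ι))).starProjection (a i) :=
  Submodule.starProjection_orthogonal_val _

theorem norm_projectOut_le (a : ι → E) (T : Finset ι) (i : ι) : ‖projectOut a T i‖ ≤ ‖a i‖ :=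
  Submodule.norm_starProjection_apply_le _ _

theorem projectOut_mem_span (a : ι → E) {T J : Finset ι} (hTJ : T ⊆ J) {i : ι} (hi : i ∈ J) :
    projectOut a T i ∈ Submodule.span ℝ (a '' (J : Set ι)) := by
  rw [projectOut_eq_sub]
  exact Submodule.sub_mem _ (Submodule.subset_span ⟨i, hi, rfl⟩)
    (Submodule.span_mono (Set.image_mono hTJ) (Submodule.starProjection_apply_mem _ _))

theorem span_projectOut_le (a : ι → E) {T Q J : Finset ι} (hTJ : T ⊆ J) (hQJ : Q ⊆ J) :
    Submodule.span ℝ (projectOut a T '' (Q : Set ι)) ≤ Submodule.span ℝ (a '' (J : Set ι)) := by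
  rw [Submodule.span_le]
  rintro _ ⟨i, hi, rfl⟩
  exact projectOut_mem_span a hTJ (hQJ hi)

variable [DecidableEq ι] {a : ι → E} {Q I T : Finset ι} {δ : ℝ} {R : Submodule ℝ E}

theorem finrank_mul_le_sum_norm_starProjection_sq (h : RestrictedIsometryOn a (Q ∪ T) δ)
    (hδ : δ < 1) (ha : ∀ i, ‖a i‖ = 1) (hQT : Disjoint Q T)
    (hR : R ≤ Submodule.span ℝ (projectOut a T '' (Q : Set ι))) :
    Module.finrank ℝ R * (1 - δ) ≤
      ∑ q ∈ Q, ‖R.starProjection (‖projectOut a T q‖⁻¹ • projectOut a T q)‖ ^ 2 := by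
  simp only [norm_starProjection_sq_eq_sum]
  rw [Finset.sum_comm]
  have key : ∀ i, 1 - δ ≤ ∑ q ∈ Q, inner ℝ (stdOrthonormalBasis ℝ R i : E)
      (‖projectOut a T q‖⁻¹ • projectOut a T q) ^ 2 := by
    intro i
    obtain ⟨x, hx⟩ := exists_sum_eq_of_mem_span_image (hR (stdOrthonormalBasis ℝ R i).2)
    have h1 := (h.projectOut hδ.le hQT).mul_norm_sq_le_sum_inner_sq hδ x
    have hn : ‖(stdOrthonormalBasis ℝ R i : E)‖ = 1 := (stdOrthonormalBasis ℝ R).norm_eq_one i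
    rw [hx, hn, one_pow, mul_one] at h1
    refine h1.trans (Finset.sum_le_sum fun q _ => ?_)
    rw [real_inner_comm _ (stdOrthonormalBasis ℝ R i : E)]
    exact inner_sq_le_inner_normalize_sq ((norm_projectOut_le a T q).trans_eq (ha q)) _
  have h2 := Finset.sum_le_sum fun i (_ : i ∈ Finset.univ) => key i
  rwa [Finset.sum_const, Finset.card_univ, Fintype.card_fin, nsmul_eq_mul] at h2

/-- Let `p = P_T^⊥ a_j`. Since `P_T a_j + P_R p` lies in the span over `Q ∪ T`, the distance bound
gives `‖p‖² - ‖P_R p‖² ≥ 1 - δ²`. As `‖p‖ ≤ 1`, dividing by `‖p‖²` still leaves at most `δ²`. -/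
theorem norm_starProjection_normalize_sq_le {j : ι}
    (h : RestrictedIsometryOn a (insert j (Q ∪ T)) δ) (hδ : 0 < δ) (hδ1 : δ < 1)
    (ha : ∀ i, ‖a i‖ = 1) (hj : j ∉ Q ∪ T)
    (hR : R ≤ Submodule.span ℝ (projectOut a T '' (Q : Set ι))) :
    ‖R.starProjection (‖projectOut a T j‖⁻¹ • projectOut a T j)‖ ^ 2 ≤ δ ^ 2 := by
  set W := Submodule.span ℝ (a '' ((Q ∪ T : Finset ι) : Set ι)) with hW
  set v := R.starProjection (projectOut a T j) with hv
  have hvW : v ∈ W := span_projectOut_le a Finset.subset_union_right Finset.subset_union_left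
    (hR (R.starProjection_apply_mem _))
  have hTW : (Submodule.span ℝ (a '' (T : Set ι))).starProjection (a j) ∈ W :=
    Submodule.span_mono (Set.image_mono Finset.subset_union_right)
      (Submodule.starProjection_apply_mem _ _)
  have h1 := (h.one_sub_sq_le hδ hδ1 hj (ha j)).trans
    (norm_sub_starProjection_sq_le W (a j) _ (W.add_mem hTW hvW))
  rw [← sub_sub, ← projectOut_eq_sub] at h1
  have h2 := Submodule.norm_sq_eq_add_norm_sq_starProjection (projectOut a T j) R
  rw [Submodule.starProjection_orthogonal_val, ← hv] at h2
  have h3 : ‖projectOut a T j‖ ^ 2 ≤ 1 :=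
    pow_le_one₀ (norm_nonneg _) ((norm_projectOut_le a T j).trans_eq (ha j))
  have h4 : 0 < ‖projectOut a T j‖ ^ 2 := by nlinarith [sq_nonneg ‖v‖]
  rw [map_smul, norm_smul, mul_pow, norm_inv, norm_norm, inv_pow, inv_mul_le_iff₀ h4]
  nlinarith

/-- For a unit vector `u` of `R` with coefficients `x` on `Q`, both sides are measured against `X =
∑ x q ^ 2`: the off-diagonal Gram bound controls `I` by `δ² X / (1 - δ²)`, and `Q` contributes at
least `(1 - δ)² X`. The factor `1 - δ²` pays for normalizing the projected columns in `I`. -/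
theorem card_mul_sum_norm_starProjection_sq_lt {c l : ℝ}
    (h : RestrictedIsometryOn a ((Q ∪ I) ∪ T) δ) (hδ : 0 < δ) (hδ1 : δ < 1)
    (ha : ∀ i, ‖a i‖ = 1) (hQI : Disjoint Q I) (hQT : Disjoint Q T) (hIT : Disjoint I T)
    (hR : R ≤ Submodule.span ℝ (projectOut a T '' (Q : Set ι))) (hR0 : 0 < Module.finrank ℝ R)
    (hc : 0 ≤ c) (hl : 0 ≤ l) (hcl : c * δ ^ 2 < l * ((1 - δ) ^ 2 * (1 - δ ^ 2))) :
    c * ∑ i ∈ I, ‖R.starProjection (‖projectOut a T i‖⁻¹ • projectOut a T i)‖ ^ 2 <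
      l * ∑ q ∈ Q, ‖R.starProjection (‖projectOut a T q‖⁻¹ • projectOut a T q)‖ ^ 2 := by
  simp only [norm_starProjection_sq_eq_sum]
  rw [Finset.sum_comm, Finset.sum_comm (s := Q), Finset.mul_sum, Finset.mul_sum]
  have : Nonempty (Fin (Module.finrank ℝ R)) := ⟨⟨0, hR0⟩⟩
  refine Finset.sum_lt_sum_of_nonempty Finset.univ_nonempty fun i _ => ?_
  set u : E := (stdOrthonormalBasis ℝ R i : E) with hu
  have hn : ‖u‖ = 1 := (stdOrthonormalBasis ℝ R).norm_eq_one i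
  obtain ⟨x, hx⟩ := exists_sum_eq_of_mem_span_image (hR (stdOrthonormalBasis ℝ R i).2)
  rw [← hu] at hx
  have hM := h.projectOut hδ1.le (Finset.disjoint_union_left.2 ⟨hQT, hIT⟩)
  have hMQ := hM.subset (I := Q) Finset.subset_union_left
  have lower := hMQ.mul_norm_sq_le_sum_inner_sq hδ1 x
  have upper := hM.sum_inner_sq_le hδ hQI x
  have nx := hMQ x
  rw [hx, hn] at lower nx
  rw [hx] at upper
  set X := ∑ q ∈ Q, x q ^ 2 with hX
  have hd : 0 < 1 - δ ^ 2 := by nlinarith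
  have u1 : ∑ i ∈ I, inner ℝ u (‖projectOut a T i‖⁻¹ • projectOut a T i) ^ 2 ≤
      (1 - δ ^ 2)⁻¹ * (δ ^ 2 * X) := by
    refine le_trans ?_ (mul_le_mul_of_nonneg_left upper (inv_nonneg.2 hd.le))
    rw [Finset.mul_sum]
    refine Finset.sum_le_sum fun j hj => ?_
    rw [real_inner_comm]
    refine inner_normalize_sq_le hd ?_ u
    rw [projectOut_eq_sub]
    refine (h.subset ?_).one_sub_sq_le hδ hδ1 (Finset.disjoint_left.1 hIT hj) (ha j)
    exact Finset.insert_subset (by simp [hj]) Finset.subset_union_right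
  have u2 : (1 - δ) ^ 2 * X ≤
      ∑ q ∈ Q, inner ℝ u (‖projectOut a T q‖⁻¹ • projectOut a T q) ^ 2 := by
    have e : (1 - δ) ^ 2 * X ≤ (1 - δ) * 1 ^ 2 := by nlinarith [nx.1]
    refine e.trans (lower.trans (Finset.sum_le_sum fun q _ => ?_))
    rw [real_inner_comm _ u]
    exact inner_sq_le_inner_normalize_sq ((norm_projectOut_le a T q).trans_eq (ha q)) _
  have hX0 : 0 < X := by
    by_contra! h0
    nlinarith [nx.2]
  have m1 := mul_le_mul_of_nonneg_left u1 hc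
  have m2 := mul_le_mul_of_nonneg_left u2 hl
  refine lt_of_le_of_lt m1 (lt_of_lt_of_le ?_ m2)
  have : c * δ ^ 2 * (1 - δ ^ 2)⁻¹ < l * (1 - δ) ^ 2 := by
    rw [mul_inv_lt_iff₀ hd]; linarith
  calc c * ((1 - δ ^ 2)⁻¹ * (δ ^ 2 * X)) = c * δ ^ 2 * (1 - δ ^ 2)⁻¹ * X := by ring
    _ < l * (1 - δ) ^ 2 * X := mul_lt_mul_of_pos_right this hX0
    _ = _ := by ring

end Scores

/-! ### The two numerical thresholds. -/

/-- When `r > 0`, the threshold is exactly the positive root of `K δ² + r δ - r`. -/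
theorem mul_sq_lt_of_lt_sqrt_div {K r δ : ℝ} (hK : 0 < K) (hr : 0 ≤ r) (hδ : 0 < δ)
    (h : δ < √r / (√(K + r / 4) + √(r / 4))) : δ < 1 ∧ K * δ ^ 2 < r * (1 - δ) := by
  set s := √(K + r / 4) with hs
  set p := √(r / 4) with hp
  have hs2 : s ^ 2 = K + r / 4 := Real.sq_sqrt (by positivity)
  have hp2 : p ^ 2 = r / 4 := Real.sq_sqrt (by positivity)
  have hp0 : 0 ≤ p := Real.sqrt_nonneg _
  have hs0 : 0 < s := Real.sqrt_pos.2 (by positivity)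
  have e : √r = 2 * p := by
    rw [Real.sqrt_eq_iff_mul_self_eq hr (by positivity)]
    nlinarith
  rw [e, lt_div_iff₀ (by positivity)] at h
  have hps : p ≤ s := Real.sqrt_le_sqrt (by linarith)
  have h1 : δ * s < (2 - δ) * p := by linarith
  have h2 := pow_lt_pow_left₀ h1 (by positivity) two_ne_zero
  have hr' : r = 4 * p ^ 2 := by linarith
  have hK' : K = s ^ 2 - p ^ 2 := by linarith
  constructor
  · by_contra! h3
    nlinarith
  · rw [hK', hr']
    nlinarith

theorem mul_sq_lt_of_lt_sqrt_div_add {K L δ : ℝ} (hL : 0 < L) (hLK : L ≤ K) (hδ : 0 < δ)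
    (h : δ < √L / (√K + 1.15 * √L)) :
    δ < 1 ∧ K * δ ^ 2 < L * ((1 - δ) ^ 2 * (1 - δ ^ 2)) := by
  have hl0 : 0 < √L := Real.sqrt_pos.2 hL
  have hkl : √L ≤ √K := Real.sqrt_le_sqrt hLK
  rw [lt_div_iff₀ (by positivity)] at h
  -- Here `L ≤ K` enters: it confines `δ` to the range where the constant 1.15 works.
  have hδ1 : 2.15 * δ < 1 := by
    by_contra! h3
    nlinarith
  have h1 : δ * √K < (1 - 1.15 * δ) * √L := by linarith
  have h2 := pow_lt_pow_left₀ h1 (by positivity) two_ne_zero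
  rw [mul_pow, mul_pow, Real.sq_sqrt (by linarith), Real.sq_sqrt hL.le] at h2
  refine ⟨by linarith, ?_⟩
  have h3 : (1 - 1.15 * δ) ^ 2 ≤ (1 - δ) ^ 2 * (1 - δ ^ 2) := by
    -- This cubic is the difference of the two sides divided by `δ`; 0.4652 lies just above 1/2.15.
    have g : 0 ≤ 0.3 - 1.3225 * δ + 2 * δ ^ 2 - δ ^ 3 := by
      have : δ ≤ 0.4652 := by linarith
      nlinarith [mul_nonneg (sub_nonneg.2 this) (sq_nonneg (δ - 0.5)),
        mul_nonneg (sub_nonneg.2 this) hδ.le, mul_nonneg (sub_nonneg.2 this) (sq_nonneg δ)]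
    nlinarith [mul_nonneg hδ.le g]
  nlinarith [mul_le_mul_of_nonneg_left h3 hL.le]

/-! ### Column spaces, least squares, rows of `X` and subspace distance. -/

section Matrices

variable {m n r : ℕ}

theorem euclCol_mul_eq_sum (A : Matrix (Fin m) (Fin n) ℝ) (U : Matrix (Fin n) (Fin r) ℝ)
    (j : Fin r) : euclCol (A * U) j = ∑ i, U i j • euclCol A i := by
  ext k
  simp [euclCol, Matrix.mul_apply, mul_comm]

theorem euclCol_sub (A B : Matrix (Fin m) (Fin n) ℝ) (j : Fin n) :
    euclCol (A - B) j = euclCol A j - euclCol B j := by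
  ext k
  simp [euclCol]

theorem toLp_mulVec_eq_sum (A : Matrix (Fin m) (Fin n) ℝ) (x : Fin n → ℝ) :
    (WithLp.toLp 2 (A.mulVec x) : EuclideanSpace ℝ (Fin m)) = ∑ i, x i • euclCol A i := by
  ext k
  simp [euclCol, Matrix.mulVec, dotProduct, mul_comm]

theorem sum_smul_euclCol_mul (A : Matrix (Fin m) (Fin n) ℝ) (U : Matrix (Fin n) (Fin r) ℝ)
    (w : Fin r → ℝ) :
    ∑ j, w j • euclCol (A * U) j = ∑ i, U.mulVec w i • euclCol A i := by
  rw [← toLp_mulVec_eq_sum, ← toLp_mulVec_eq_sum, Matrix.mulVec_mulVec]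

theorem mem_rowSupport {X : Matrix (Fin n) (Fin r) ℝ} {i : Fin n} :
    i ∈ rowSupport X ↔ X i ≠ 0 := by
  simp [rowSupport]

theorem row_eq_zero_of_notMem {X : Matrix (Fin n) (Fin r) ℝ} {T : Finset (Fin n)}
    (h : rowSupport X ⊆ T) {i : Fin n} (hi : i ∉ T) : X i = 0 := by
  by_contra h0
  exact hi (h (mem_rowSupport.2 h0))

theorem mulVec_eq_zero_of_notMem {X : Matrix (Fin n) (Fin r) ℝ} {T : Finset (Fin n)}
    (h : rowSupport X ⊆ T) {i : Fin n} (hi : i ∉ T) (w : Fin r → ℝ) : X.mulVec w i = 0 := by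
  rw [Matrix.mulVec, row_eq_zero_of_notMem h hi, zero_dotProduct]

theorem RIPBound.restrictedIsometryOn {A : Matrix (Fin m) (Fin n) ℝ} {s : ℕ} {δ : ℝ}
    (h : RIPBound A s δ) {J : Finset (Fin n)} (hJ : J.card ≤ s) :
    RestrictedIsometryOn (euclCol A) J δ := by
  intro x
  have h1 := h (WithLp.toLp 2 fun i => if i ∈ J then x i else 0) (by
    refine le_trans (Finset.card_le_card fun i hi => ?_) hJ
    by_contra h0
    simp [h0] at hi)
  rw [toLp_mulVec_eq_sum, EuclideanSpace.norm_sq_eq] at h1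
  simpa [ite_pow] using h1

theorem RIPBound.mono {A : Matrix (Fin m) (Fin n) ℝ} {s : ℕ} {δ ε : ℝ}
    (h : RIPBound A s δ) (hδ : δ ≤ ε) : RIPBound A s ε := fun x hx =>
  ⟨(mul_le_mul_of_nonneg_right (by linarith) (sq_nonneg _)).trans (h x hx).1,
    (h x hx).2.trans (mul_le_mul_of_nonneg_right (by linarith) (sq_nonneg _))⟩

theorem fullColumnRankOn_iff {A : Matrix (Fin m) (Fin n) ℝ} {J : Finset (Fin n)} :
    FullColumnRankOn A J ↔
      ∀ x : Fin n → ℝ, ∑ i ∈ J, x i • euclCol A i = 0 → ∀ i ∈ J, x i = 0 := by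
  rw [FullColumnRankOn, Fintype.linearIndependent_iff]
  constructor
  · intro h x hx i hi
    refine h (fun j => x j) ?_ ⟨i, hi⟩
    rw [← hx, ← Finset.sum_coe_sort J]
  · intro h g hg i
    have := h (fun i => if hi : i ∈ J then g ⟨i, hi⟩ else 0) (by
      rw [← hg, ← Finset.sum_coe_sort J]
      exact Finset.sum_congr rfl fun i _ => by simp) i i.2
    simpa using this

theorem RIPBound.fullColumnRankOn {A : Matrix (Fin m) (Fin n) ℝ} {s : ℕ} {δ : ℝ}
    (h : RIPBound A s δ) (hδ : δ < 1) {J : Finset (Fin n)} (hJ : J.card ≤ s) :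
    FullColumnRankOn A J :=
  fullColumnRankOn_iff.2 fun _ hx _ hi =>
    (h.restrictedIsometryOn hJ).sum_smul_eq_zero hδ hx hi

theorem FullColumnRankOn.subset {A : Matrix (Fin m) (Fin n) ℝ} {I J : Finset (Fin n)}
    (h : FullColumnRankOn A J) (hIJ : I ⊆ J) : FullColumnRankOn A I :=
  h.comp (Set.inclusion (by exact_mod_cast hIJ)) (Set.inclusion_injective _)

theorem fullColumnRankOn_of_card_le_krank {A : Matrix (Fin m) (Fin n) ℝ} {J : Finset (Fin n)}
    (hJ : J.card ≤ krank A) : FullColumnRankOn A J := by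
  have hmem : krank A ∈ {k : ℕ | k ≤ n ∧ ∀ J : Finset (Fin n), J.card = k →
      FullColumnRankOn A J} := by
    refine Nat.sSup_mem ⟨0, Nat.zero_le _, fun J hJ => ?_⟩ ⟨n, fun k hk => hk.1⟩
    rw [Finset.card_eq_zero] at hJ
    subst hJ
    exact fullColumnRankOn_iff.2 (by simp)
  obtain ⟨I, hJI, hI⟩ := Finset.exists_superset_card_eq hJ (by simpa using hmem.1)
  exact (hmem.2 I hI).subset hJI

theorem frobNorm_eq (H : Matrix (Fin m) (Fin n) ℝ) :
    frobNorm H = √(∑ j, ‖euclCol H j‖ ^ 2) := by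
  rw [frobNorm, Finset.sum_comm]
  congr 1
  refine Finset.sum_congr rfl fun j _ => ?_
  rw [EuclideanSpace.norm_sq_eq]
  simp [euclCol]

theorem frobNorm_le_iff {H G : Matrix (Fin m) (Fin n) ℝ} :
    frobNorm H ≤ frobNorm G ↔ ∑ j, ‖euclCol H j‖ ^ 2 ≤ ∑ j, ‖euclCol G j‖ ^ 2 := by
  rw [frobNorm_eq, frobNorm_eq, Real.sqrt_le_sqrt_iff (Finset.sum_nonneg fun j _ => sq_nonneg _)]

theorem euclCol_mul_eq_sum_of_rowSupport_subset (A : Matrix (Fin m) (Fin n) ℝ)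
    {U : Matrix (Fin n) (Fin r) ℝ} {T : Finset (Fin n)} (hU : rowSupport U ⊆ T) (j : Fin r) :
    euclCol (A * U) j = ∑ i ∈ T, U i j • euclCol A i := by
  rw [euclCol_mul_eq_sum]
  symm
  refine Finset.sum_subset (Finset.subset_univ _) fun i _ hi => ?_
  rw [row_eq_zero_of_notMem hU hi]
  simp

theorem euclCol_mul_mem_colSpaceOn (A : Matrix (Fin m) (Fin n) ℝ)
    {U : Matrix (Fin n) (Fin r) ℝ} {T : Finset (Fin n)} (hU : rowSupport U ⊆ T) (j : Fin r) :
    euclCol (A * U) j ∈ colSpaceOn A T := by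
  rw [euclCol_mul_eq_sum_of_rowSupport_subset A hU]
  exact sum_smul_mem_span_image _ subset_rfl _

theorem exists_euclCol_mul_eq_starProjection (A : Matrix (Fin m) (Fin n) ℝ)
    (Y : Matrix (Fin m) (Fin r) ℝ) (T : Finset (Fin n)) :
    ∃ U : Matrix (Fin n) (Fin r) ℝ, rowSupport U ⊆ T ∧
      ∀ j, euclCol (A * U) j = (colSpaceOn A T).starProjection (euclCol Y j) := by
  choose z hz using fun j => exists_sum_eq_of_mem_span_image
    ((colSpaceOn A T).starProjection_apply_mem (euclCol Y j))
  have hU : rowSupport (fun i j => if i ∈ T then z j i else 0 : Matrix (Fin n) (Fin r) ℝ) ⊆ T := by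
    intro i hi
    by_contra h0
    refine mem_rowSupport.1 hi (funext fun j => ?_)
    simp [h0]
  refine ⟨_, hU, fun j => ?_⟩
  rw [euclCol_mul_eq_sum_of_rowSupport_subset A hU, ← hz]
  exact Finset.sum_congr rfl fun i hi => by rw [if_pos hi]

theorem norm_sub_sq_eq_of_mem {E : Type*} [NormedAddCommGroup E] [InnerProductSpace ℝ E]
    [FiniteDimensional ℝ E] {W : Submodule ℝ E} (v : E) {w : E} (hw : w ∈ W) :
    ‖v - w‖ ^ 2 = ‖v - W.starProjection v‖ ^ 2 + ‖W.starProjection v - w‖ ^ 2 := by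
  have h : inner ℝ (v - W.starProjection v) (W.starProjection v - w) = (0 : ℝ) :=
    Submodule.starProjection_inner_eq_zero _ _ (W.sub_mem (W.starProjection_apply_mem v) hw)
  have h2 : v - w = (v - W.starProjection v) + (W.starProjection v - w) := by abel
  rw [h2, norm_add_sq_real, h]
  ring

/-- By Pythagoras in each column. In particular the residual does not depend on which minimizer is
chosen. -/
theorem SSMP.isLeastSquares_iff {A : Matrix (Fin m) (Fin n) ℝ} {Y : Matrix (Fin m) (Fin r) ℝ}
    {T : Finset (Fin n)} {U : Matrix (Fin n) (Fin r) ℝ} :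
    SSMP.IsLeastSquares A Y T U ↔ rowSupport U ⊆ T ∧
      ∀ j, euclCol (A * U) j = (colSpaceOn A T).starProjection (euclCol Y j) := by
  constructor
  · rintro ⟨hU, hmin⟩
    refine ⟨hU, ?_⟩
    obtain ⟨V, hV, hVj⟩ := exists_euclCol_mul_eq_starProjection A Y T
    have h1 := frobNorm_le_iff.1 (hmin V hV)
    simp only [euclCol_sub, hVj] at h1
    simp only [fun j => norm_sub_sq_eq_of_mem (euclCol Y j) (euclCol_mul_mem_colSpaceOn A hU j),
      Finset.sum_add_distrib] at h1
    have h2 : ∑ j, ‖(colSpaceOn A T).starProjection (euclCol Y j) - euclCol (A * U) j‖ ^ 2 = 0 :=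
      le_antisymm (by linarith) (Finset.sum_nonneg fun j _ => sq_nonneg _)
    rw [Finset.sum_eq_zero_iff_of_nonneg fun j _ => sq_nonneg _] at h2
    intro j
    have h3 := h2 j (Finset.mem_univ j)
    rw [sq_eq_zero_iff, norm_eq_zero, sub_eq_zero] at h3
    exact h3.symm
  · rintro ⟨hU, hj⟩
    refine ⟨hU, fun V hV => frobNorm_le_iff.2 (Finset.sum_le_sum fun j _ => ?_)⟩
    rw [euclCol_sub, euclCol_sub, hj]
    exact norm_sub_starProjection_sq_le _ _ _ (euclCol_mul_mem_colSpaceOn A hV j)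

theorem SSMP.exists_isLeastSquares (A : Matrix (Fin m) (Fin n) ℝ) (Y : Matrix (Fin m) (Fin r) ℝ)
    (T : Finset (Fin n)) : ∃ U, SSMP.IsLeastSquares A Y T U := by
  obtain ⟨U, hU⟩ := exists_euclCol_mul_eq_starProjection A Y T
  exact ⟨U, SSMP.isLeastSquares_iff.2 hU⟩

section Rows

variable {X : Matrix (Fin n) (Fin r) ℝ}

theorem AnyNonzeroRowsIndep.eq_zero_of_mulVec_eq_zero (hX : AnyNonzeroRowsIndep r X)
    {Q : Finset (Fin n)} (hQ : Q ⊆ rowSupport X) (hr : r ≤ Q.card) {w : Fin r → ℝ}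
    (hw : ∀ q ∈ Q, X.mulVec w q = 0) : w = 0 := by
  obtain ⟨J, hJQ, hJ⟩ := Finset.exists_subset_card_eq hr
  have hli := hX J (hJQ.trans hQ) hJ
  have htop : Submodule.span ℝ (Set.range fun i : J => X (i : Fin n)) = ⊤ :=
    hli.span_eq_top_of_card_eq_finrank' (by simp [hJ])
  have hall : ∀ v : Fin r → ℝ, v ⬝ᵥ w = 0 := by
    intro v
    have hv : v ∈ Submodule.span ℝ (Set.range fun i : J => X (i : Fin n)) := htop ▸ trivial
    induction hv using Submodule.span_induction with
    | mem x hx => obtain ⟨i, rfl⟩ := hx; exact hw i (hJQ i.2)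
    | zero => exact zero_dotProduct _
    | add x y _ _ hx hy => rw [add_dotProduct, hx, hy, add_zero]
    | smul c x _ hx => rw [smul_dotProduct, hx, smul_zero]
  exact dotProduct_self_eq_zero.1 (hall w)

theorem le_card_rowSupport (hX : LinearIndependent ℝ (fun j : Fin r => euclCol X j)) :
    r ≤ (rowSupport X).card := by
  let f := (X.submatrix (Subtype.val : rowSupport X → Fin n) id).mulVecLin
  have hf : Function.Injective f := by
    rw [← LinearMap.ker_eq_bot, LinearMap.ker_eq_bot']
    intro w hw
    refine funext (Fintype.linearIndependent_iff.1 hX w ?_)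
    rw [← toLp_mulVec_eq_sum]
    ext i
    by_cases hi : i ∈ rowSupport X
    · exact congrFun hw ⟨i, hi⟩
    · exact mulVec_eq_zero_of_notMem subset_rfl hi w
  simpa using LinearMap.finrank_le_finrank_of_injective hf

/-- Enlarging `Q` to `r` support rows gives an invertible square block, so values on `Q` can be
prescribed freely. -/
theorem AnyNonzeroRowsIndep.exists_mulVec_eq (hX : AnyNonzeroRowsIndep r X)
    (hr : r ≤ (rowSupport X).card) {Q : Finset (Fin n)} (hQ : Q ⊆ rowSupport X)
    (hQr : Q.card ≤ r) (t : Fin n → ℝ) : ∃ w : Fin r → ℝ, ∀ q ∈ Q, X.mulVec w q = t q := by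
  obtain ⟨J, hQJ, hJS, hJ⟩ := Finset.exists_subsuperset_card_eq hQ hQr hr
  let f := (X.submatrix (Subtype.val : J → Fin n) id).mulVecLin
  have hf : Function.Injective f := by
    rw [← LinearMap.ker_eq_bot, LinearMap.ker_eq_bot']
    intro w hw
    exact hX.eq_zero_of_mulVec_eq_zero hJS hJ.ge fun q hq => congrFun hw ⟨q, hq⟩
  obtain ⟨w, hw⟩ := (LinearMap.injective_iff_surjective_of_finrank_eq_finrank
    (by simp [hJ])).1 hf (fun i => t i)
  exact ⟨w, fun q hq => congrFun hw ⟨q, hQJ hq⟩⟩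

end Rows

section Distance

variable {V W : Submodule ℝ (EuclideanSpace ℝ (Fin m))}

theorem subspaceDist_eq (V W : Submodule ℝ (EuclideanSpace ℝ (Fin m))) :
    subspaceDist V W = √(max (Module.finrank ℝ V : ℝ) (Module.finrank ℝ W : ℝ) -
      ∑ i, ‖W.starProjection (stdOrthonormalBasis ℝ V i : EuclideanSpace ℝ (Fin m))‖ ^ 2) := by
  rw [subspaceDist]
  congr 2
  refine Finset.sum_congr rfl fun i _ => ?_
  rw [norm_starProjection_sq_eq_sum]
  exact Finset.sum_congr rfl fun j _ => by rw [sq_abs, real_inner_comm]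

theorem subspaceDist_self (V : Submodule ℝ (EuclideanSpace ℝ (Fin m))) :
    subspaceDist V V = 0 := by
  have h : ∀ i, ‖V.starProjection
      (stdOrthonormalBasis ℝ V i : EuclideanSpace ℝ (Fin m))‖ ^ 2 = 1 := fun i => by
    rw [Submodule.starProjection_eq_self_iff.2 (stdOrthonormalBasis ℝ V i).2, ← Submodule.coe_norm,
      (stdOrthonormalBasis ℝ V).norm_eq_one, one_pow]
  rw [subspaceDist_eq, Finset.sum_congr rfl fun i _ => h i]
  simp

/-- The squared distance dominates `∑ (1 - ‖P_W v_i‖²)`, whose terms are nonnegative; all vanish, so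
every basis vector lies in `W`. -/
theorem le_of_subspaceDist_nonpos (h : subspaceDist V W ≤ 0) : V ≤ W := by
  rw [subspaceDist_eq] at h
  have h1 := Real.sqrt_eq_zero'.1 (le_antisymm h (Real.sqrt_nonneg _))
  have hn : ∀ i, ‖(stdOrthonormalBasis ℝ V i : EuclideanSpace ℝ (Fin m))‖ = 1 := fun i =>
    (stdOrthonormalBasis ℝ V).norm_eq_one i
  have hle : ∀ i, 0 ≤ 1 - ‖W.starProjection
      (stdOrthonormalBasis ℝ V i : EuclideanSpace ℝ (Fin m))‖ ^ 2 := fun i =>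
    sub_nonneg.2 (pow_le_one₀ (norm_nonneg _)
      ((Submodule.norm_starProjection_apply_le _ _).trans_eq (hn i)))
  have h2 : ∑ i, (1 - ‖W.starProjection
      (stdOrthonormalBasis ℝ V i : EuclideanSpace ℝ (Fin m))‖ ^ 2) = 0 := by
    refine le_antisymm ?_ (Finset.sum_nonneg fun i _ => hle i)
    rw [Finset.sum_sub_distrib]
    simp only [Finset.sum_const, Finset.card_univ, Fintype.card_fin, nsmul_eq_mul, mul_one]
    linarith [le_max_left (Module.finrank ℝ V : ℝ) (Module.finrank ℝ W : ℝ)]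
  rw [Finset.sum_eq_zero_iff_of_nonneg fun i _ => hle i] at h2
  have hmem : ∀ i, (stdOrthonormalBasis ℝ V i : EuclideanSpace ℝ (Fin m)) ∈ W := by
    intro i
    have h3 := h2 i (Finset.mem_univ i)
    have h4 := Submodule.norm_sq_eq_add_norm_sq_starProjection
      (stdOrthonormalBasis ℝ V i : EuclideanSpace ℝ (Fin m)) W
    rw [Submodule.starProjection_orthogonal_val, hn i] at h4
    have h5 : ‖(stdOrthonormalBasis ℝ V i : EuclideanSpace ℝ (Fin m)) - W.starProjection
      (stdOrthonormalBasis ℝ V i : EuclideanSpace ℝ (Fin m))‖ ^ 2 = 0 := by linarith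
    rw [sq_eq_zero_iff, norm_eq_zero, sub_eq_zero] at h5
    rw [h5]
    exact W.starProjection_apply_mem _
  intro v hv
  have h6 := congrArg Subtype.val ((stdOrthonormalBasis ℝ V).sum_repr ⟨v, hv⟩)
  rw [Submodule.coe_sum] at h6
  change _ = v at h6
  rw [← h6]
  exact Submodule.sum_mem _ fun i _ => W.smul_mem _ (hmem i)

end Distance

end Matrices

/-! ### The residual space, one selection step, and exact recovery. -/

namespace SSMP

variable {m n r : ℕ} {A : Matrix (Fin m) (Fin n) ℝ} {X : Matrix (Fin n) (Fin r) ℝ}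
  {T I : Finset (Fin n)} {U : Matrix (Fin n) (Fin r) ℝ}

/-- The residual is `P_T^⊥ A X`: projection kills the columns in `T`, and rows of `X` off its
support vanish, leaving only missing indices. -/
theorem sum_smul_residual (hU : IsLeastSquares A (A * X) T U) (w : Fin r → ℝ) :
    ∑ j, w j • euclCol (A * X - A * U) j =
      ∑ q ∈ rowSupport X \ T, X.mulVec w q • projectOut (euclCol A) T q := by
  have h1 : ∀ j, euclCol (A * X - A * U) j =
      (colSpaceOn A T)ᗮ.starProjection (euclCol (A * X) j) := fun j => by
    rw [euclCol_sub, (isLeastSquares_iff.1 hU).2, Submodule.starProjection_orthogonal_val]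
  simp only [h1, ← map_smul]
  rw [← map_sum, sum_smul_euclCol_mul, map_sum]
  symm
  simp only [map_smul]
  refine Finset.sum_subset (Finset.subset_univ _) fun i _ hi => ?_
  by_cases hT : i ∈ T
  · have : projectOut (euclCol A) T i = 0 := by
      have hi' : euclCol A i ∈ Submodule.span ℝ (euclCol A '' (T : Set (Fin n))) :=
        Submodule.subset_span ⟨i, hT, rfl⟩
      rw [projectOut_eq_sub, Submodule.starProjection_eq_self_iff.2 hi', sub_self]
    rw [this, smul_zero]
  · have hS : i ∉ rowSupport X := fun h => hi (Finset.mem_sdiff.2 ⟨h, hT⟩)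
    rw [mulVec_eq_zero_of_notMem subset_rfl hS, zero_smul]

theorem mem_colSpace_residual (hU : IsLeastSquares A (A * X) T U)
    {v : EuclideanSpace ℝ (Fin m)} :
    v ∈ colSpace (A * X - A * U) ↔
      ∃ w, ∑ q ∈ rowSupport X \ T, X.mulVec w q • projectOut (euclCol A) T q = v := by
  rw [colSpace, Submodule.mem_span_range_iff_exists_fun]
  simp only [sum_smul_residual hU]

theorem colSpace_residual_le (hU : IsLeastSquares A (A * X) T U) :
    colSpace (A * X - A * U) ≤
      Submodule.span ℝ (projectOut (euclCol A) T '' ((rowSupport X \ T : Finset _) : Set _)) := by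
  intro v hv
  obtain ⟨w, rfl⟩ := (mem_colSpace_residual hU).1 hv
  exact sum_smul_mem_span_image _ subset_rfl _

theorem finrank_colSpace_residual {δ : ℝ} (hU : IsLeastSquares A (A * X) T U)
    (hX : AnyNonzeroRowsIndep r X) (hr : r ≤ (rowSupport X \ T).card)
    (h : RestrictedIsometryOn (euclCol A) (rowSupport X \ T ∪ T) δ) (hδ : δ < 1) :
    Module.finrank ℝ (colSpace (A * X - A * U)) = r := by
  have hli : LinearIndependent ℝ (euclCol (A * X - A * U)) := by
    rw [Fintype.linearIndependent_iff]
    intro w hw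
    rw [sum_smul_residual hU] at hw
    refine congrFun (hX.eq_zero_of_mulVec_eq_zero Finset.sdiff_subset hr fun q hq => ?_)
    exact (h.projectOut hδ.le Finset.sdiff_disjoint).sum_smul_eq_zero hδ hw hq
  exact (finrank_span_eq_card hli).trans (Fintype.card_fin r)

theorem IsSelected.subset_or_card_eq {R : Matrix (Fin m) (Fin r) ℝ} {L : ℕ}
    (hI : IsSelected A R T L I) : Finset.univ \ T ⊆ I ∨ I.card = L := by
  obtain ⟨hd, hcard, -⟩ := hI
  have hsub : I ⊆ Finset.univ \ T := fun i hi =>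
    Finset.mem_sdiff.2 ⟨Finset.mem_univ i, Finset.disjoint_left.1 hd hi⟩
  rcases le_total L (Finset.univ \ T).card with h | h
  · exact Or.inr (by rw [hcard, min_eq_left h])
  · rw [min_eq_right h] at hcard
    exact Or.inl (Finset.eq_of_subset_of_card_le hsub hcard.ge).ge

/-- While more than `r` support indices are missing, the selection contains one of them. -/
theorem IsSelected.not_disjoint_rowSupport {δ : ℝ} {N K L : ℕ}
    (hI : IsSelected A (A * X - A * U) T L I) (hU : IsLeastSquares A (A * X) T U)
    (hrip : RIPBound A N δ) (hδ0 : 0 < δ) (hδ1 : δ < 1) (hA : ∀ j, ‖euclCol A j‖ = 1)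
    (hX : AnyNonzeroRowsIndep r X) (hL : 1 ≤ L) (hK : (rowSupport X).card ≤ K)
    (hr : r < (rowSupport X \ T).card) (hN : (rowSupport X \ T).card + T.card + L ≤ N)
    (hδ : K * δ ^ 2 < r * (1 - δ) ∨ K * δ ^ 2 < L * ((1 - δ) ^ 2 * (1 - δ ^ 2))) :
    ¬ Disjoint I (rowSupport X) := by
  intro hd
  set Q := rowSupport X \ T with hQ
  have hQT : Disjoint Q T := Finset.sdiff_disjoint
  have hIT : Disjoint I T := hI.1
  have hQI : Disjoint Q I := (hd.mono_right Finset.sdiff_subset).symm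
  obtain ⟨q0, hq0⟩ : Q.Nonempty := Finset.card_pos.1 (by omega)
  have hIL : I.card = L := by
    refine hI.subset_or_card_eq.resolve_left fun h => ?_
    exact Finset.disjoint_left.1 hQI hq0
      (h (Finset.mem_sdiff.2 ⟨Finset.mem_univ _, Finset.disjoint_left.1 hQT hq0⟩))
  -- For `r = 0` every row is an empty vector, so no row could be nonzero.
  have hrpos : 0 < r := by
    rcases Nat.eq_zero_or_pos r with rfl | h
    · exact absurd (Subsingleton.elim _ _) (mem_rowSupport.1 (Finset.mem_sdiff.1 hq0).1)
    · exact h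
  have hcK : (Q.card : ℝ) ≤ K := by
    exact_mod_cast (Finset.card_le_card Finset.sdiff_subset).trans hK
  have hripQT : RestrictedIsometryOn (euclCol A) (Q ∪ T) δ :=
    hrip.restrictedIsometryOn ((Finset.card_union_le _ _).trans (by omega))
  have hrank := finrank_colSpace_residual hU hX hr.le hripQT hδ1
  have hle := colSpace_residual_le hU
  have hscore : ∀ q ∈ Q, ∀ i ∈ I, score A (A * X - A * U) T q ^ 2 ≤
      score A (A * X - A * U) T i ^ 2 := fun q hq i hi =>
    pow_le_pow_left₀ (norm_nonneg _) (hI.2.2 i hi q (Finset.disjoint_left.1 hQT hq)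
      (Finset.disjoint_left.1 hQI hq)) 2
  -- The first condition compares all of `Q` with a single wrong index. The second averages over all
  -- pairs in `Q × I`, which needs isometry on all of `Q ∪ I ∪ T`.
  rcases hδ with h | h
  · obtain ⟨j, hj⟩ : I.Nonempty := Finset.card_pos.1 (by omega)
    have hjQT : j ∉ Q ∪ T := by
      rw [Finset.mem_union, not_or]
      exact ⟨Finset.disjoint_right.1 hQI hj, Finset.disjoint_left.1 hIT hj⟩
    have h1 := finrank_mul_le_sum_norm_starProjection_sq hripQT hδ1 hA hQT hle
    have h2 : score A (A * X - A * U) T j ^ 2 ≤ δ ^ 2 := by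
      refine norm_starProjection_normalize_sq_le (hrip.restrictedIsometryOn ?_) hδ0 hδ1 hA hjQT hle
      have := Finset.card_union_le Q T
      exact (Finset.card_insert_le _ _).trans (by omega)
    have h3 : ∑ q ∈ Q, score A (A * X - A * U) T q ^ 2 ≤ Q.card * δ ^ 2 := by
      rw [← nsmul_eq_mul]
      exact Finset.sum_le_card_nsmul _ _ _ fun q hq => (hscore q hq j hj).trans h2
    have h4 := h1.trans h3
    rw [hrank] at h4
    nlinarith [mul_le_mul_of_nonneg_right hcK (sq_nonneg δ)]
  · have hripA : RestrictedIsometryOn (euclCol A) (Q ∪ I ∪ T) δ := by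
      refine hrip.restrictedIsometryOn ?_
      have h1 := Finset.card_union_le Q I
      have h2 := Finset.card_union_le (Q ∪ I) T
      omega
    have h1 := card_mul_sum_norm_starProjection_sq_lt (c := Q.card) (l := L) hripA hδ0 hδ1 hA hQI
      hQT hIT hle (by omega) (Nat.cast_nonneg _) (Nat.cast_nonneg _)
      (lt_of_le_of_lt (mul_le_mul_of_nonneg_right hcK (sq_nonneg δ)) h)
    have h2 : ∑ q ∈ Q, ∑ i ∈ I, score A (A * X - A * U) T q ^ 2 ≤
        ∑ q ∈ Q, ∑ i ∈ I, score A (A * X - A * U) T i ^ 2 :=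
      Finset.sum_le_sum fun q hq => Finset.sum_le_sum fun i hi => hscore q hq i hi
    simp only [Finset.sum_const, nsmul_eq_mul, ← Finset.mul_sum, hIL] at h2
    exact absurd h1 (not_lt.2 h2)

theorem notMem_colSpaceOn {J : Finset (Fin n)} {j : Fin n} (h : FullColumnRankOn A (insert j J))
    (hj : j ∉ J) : euclCol A j ∉ colSpaceOn A J := by
  intro hmem
  obtain ⟨z, hz⟩ := exists_sum_eq_of_mem_span_image hmem
  have h1 := fullColumnRankOn_iff.1 h (fun i => if i ∈ J then z i else -1) (by
    rw [Finset.sum_insert hj, if_neg hj, neg_one_smul, ← hz, neg_add_eq_zero]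
    exact Finset.sum_congr rfl fun i hi => by rw [if_pos hi]) j (Finset.mem_insert_self _ _)
  simp [hj] at h1

/-- Once at most `r` support indices are missing, the selection consists of missing support
indices or contains all of them. -/
theorem IsSelected.subset_or_subset {N L : ℕ} (hI : IsSelected A (A * X - A * U) T L I)
    (hU : IsLeastSquares A (A * X) T U)
    (hind : ∀ J : Finset (Fin n), J.card ≤ N → FullColumnRankOn A J)
    (hX : AnyNonzeroRowsIndep r X) (hrX : r ≤ (rowSupport X).card)
    (hr : (rowSupport X \ T).card ≤ r) (hN : (rowSupport X \ T).card + T.card + 1 ≤ N) :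
    I ⊆ rowSupport X \ T ∨ rowSupport X \ T ⊆ I := by
  by_contra! hcon
  obtain ⟨⟨j, hjI, hjQ⟩, ⟨q, hqQ, hqI⟩⟩ := And.intro (Finset.not_subset.1 hcon.1)
    (Finset.not_subset.1 hcon.2)
  set Q := rowSupport X \ T with hQ
  have hjT : j ∉ T := Finset.disjoint_left.1 hI.1 hjI
  have hqT : q ∉ T := (Finset.mem_sdiff.1 hqQ).2
  have hle := hI.2.2 j hjI q hqT hqI
  have hcQT := Finset.card_union_le Q T
  have hqscore : score A (A * X - A * U) T q = 1 := by
    -- Prescribing the indicator of `q` on `Q` isolates the projected column of `q` inside the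
    -- residual space.
    obtain ⟨w, hw⟩ := hX.exists_mulVec_eq hrX Finset.sdiff_subset hr (fun i => if i = q then 1 else 0)
    have hmem : projectOut (euclCol A) T q ∈ colSpace (A * X - A * U) := by
      refine (mem_colSpace_residual hU).2 ⟨w, ?_⟩
      rw [Finset.sum_congr rfl fun i hi => by rw [hw i hi]]
      simp [← hQ, hqQ]
    have hne : projectOut (euclCol A) T q ≠ 0 := by
      intro h0
      rw [projectOut_eq_sub, sub_eq_zero] at h0
      refine notMem_colSpaceOn (hind _ ?_) hqT (h0 ▸ Submodule.starProjection_apply_mem _ _)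
      have := Finset.card_pos.2 ⟨q, hqQ⟩
      exact (Finset.card_insert_le _ _).trans (by omega)
    have hb : normalizedCol A T q ∈ colSpace (A * X - A * U) := Submodule.smul_mem _ _ hmem
    rw [score, Submodule.starProjection_eq_self_iff.2 hb]
    exact norm_smul_inv_norm hne
  -- A score of 1 would put the normalized column in the residual space, hence `a_j` in the span of
  -- the columns over `Q ∪ T`, against independence.
  have hjscore : score A (A * X - A * U) T j < 1 := by
    by_contra! h1
    have hjQT : j ∉ Q ∪ T := by
      rw [Finset.mem_union, not_or]
      exact ⟨hjQ, hjT⟩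
    have hn : ‖normalizedCol A T j‖ ≤ 1 := by
      rw [normalizedCol, norm_smul, norm_inv, norm_norm]
      exact inv_mul_le_one
    have hmem : normalizedCol A T j ∈ colSpace (A * X - A * U) :=
      (Submodule.mem_iff_norm_starProjection _ _).2
        (le_antisymm (Submodule.norm_starProjection_apply_le _ _) (hn.trans h1))
    have hW := span_projectOut_le (euclCol A) Finset.subset_union_right Finset.subset_union_left
      (colSpace_residual_le hU hmem)
    refine notMem_colSpaceOn (J := Q ∪ T) (hind _ ?_) hjQT ?_
    · exact (Finset.card_insert_le _ _).trans (by omega)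
    have h2 : euclCol A j = projectOut (euclCol A) T j +
        (colSpaceOn A T).starProjection (euclCol A j) := by
      rw [projectOut_eq_sub, colSpaceOn, sub_add_cancel]
    have h3 : projectOut (euclCol A) T j =
        ‖projectOut (euclCol A) T j‖ • normalizedCol A T j := by
      rcases eq_or_ne (projectOut (euclCol A) T j) 0 with h0 | h0
      · rw [h0, norm_zero, zero_smul]
      · change _ = _ • (‖projectOut (euclCol A) T j‖⁻¹ • projectOut (euclCol A) T j)
        rw [smul_smul, mul_inv_cancel₀ (norm_ne_zero_iff.2 h0), one_smul]
    rw [h2, h3]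
    exact Submodule.add_mem _ (Submodule.smul_mem _ _ hW)
      (Submodule.span_mono (Set.image_mono Finset.subset_union_right)
        (Submodule.starProjection_apply_mem _ _))
  linarith

theorem colSpace_mul_le_colSpaceOn (h : rowSupport X ⊆ T) : colSpace (A * X) ≤ colSpaceOn A T := by
  rw [colSpace, Submodule.span_le]
  rintro _ ⟨j, rfl⟩
  exact euclCol_mul_mem_colSpaceOn A h j

theorem subspaceDist_eq_zero_of_rowSupport_subset (h : rowSupport X ⊆ T) :
    subspaceDist (colSpace (A * X))
      ((colSpace (A * X)).map ((colSpaceOn A T).starProjection : _ →ₗ[ℝ] _)) = 0 := by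
  have : (colSpace (A * X)).map ((colSpaceOn A T).starProjection : _ →ₗ[ℝ] _) =
      colSpace (A * X) := by
    ext v
    rw [Submodule.mem_map]
    have hfix : ∀ u ∈ colSpace (A * X), (colSpaceOn A T).starProjection u = u := fun u hu =>
      Submodule.starProjection_eq_self_iff.2 (colSpace_mul_le_colSpaceOn h hu)
    constructor
    · rintro ⟨u, hu, rfl⟩
      simpa [hfix u hu] using hu
    · exact fun hv => ⟨v, hv, hfix v hv⟩
  rw [this, subspaceDist_self]

/-- Zero distance puts each column of `A X` in the span over `T`; uniqueness of coefficients on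
`rowSupport X ∪ T` then kills the rows of `X` outside `T`. -/
theorem rowSupport_subset_of_subspaceDist_nonpos
    (hind : FullColumnRankOn A (rowSupport X ∪ T))
    (h : subspaceDist (colSpace (A * X))
      ((colSpace (A * X)).map ((colSpaceOn A T).starProjection : _ →ₗ[ℝ] _)) ≤ 0) :
    rowSupport X ⊆ T := by
  intro i hi
  by_contra hiT
  refine mem_rowSupport.1 hi (funext fun j => ?_)
  have hmem : euclCol (A * X) j ∈ colSpaceOn A T := by
    obtain ⟨u, -, hu⟩ := le_of_subspaceDist_nonpos h (Submodule.subset_span ⟨j, rfl⟩)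
    rw [← hu]
    exact Submodule.starProjection_apply_mem _ _
  obtain ⟨z, hz⟩ := exists_sum_eq_of_mem_span_image hmem
  have h1 := fullColumnRankOn_iff.1 hind (fun i => X i j - if i ∈ T then z i else 0) (by
    simp only [sub_smul, Finset.sum_sub_distrib]
    rw [← euclCol_mul_eq_sum_of_rowSupport_subset A Finset.subset_union_left, sub_eq_zero, ← hz,
      ← Finset.sum_subset (Finset.subset_union_right (s₁ := rowSupport X)) fun i _ hi => by
        simp [hi]]
    exact Finset.sum_congr rfl fun i hi => by rw [if_pos hi]) i (Finset.mem_union_left _ hi)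
  simpa [hiT] using h1

theorem IsLeastSquares.eq_of_fullColumnRankOn (hU : IsLeastSquares A (A * X) T U)
    (h : rowSupport X ⊆ T) (hT : FullColumnRankOn A T) : U = X := by
  obtain ⟨hUT, hUj⟩ := isLeastSquares_iff.1 hU
  ext i j
  by_cases hi : i ∈ T
  · have h1 := hUj j
    rw [Submodule.starProjection_eq_self_iff.2 (euclCol_mul_mem_colSpaceOn A h j),
      euclCol_mul_eq_sum_of_rowSupport_subset A h, euclCol_mul_eq_sum_of_rowSupport_subset A hUT,
      ← sub_eq_zero, ← Finset.sum_sub_distrib] at h1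
    simp only [← sub_smul] at h1
    exact sub_eq_zero.1 (fullColumnRankOn_iff.1 hT (fun i => U i j - X i j) h1 i hi)
  · rw [row_eq_zero_of_notMem hUT hi, row_eq_zero_of_notMem h hi]

theorem IsPruned.rowSupport_subset {K : ℕ} {J : Finset (Fin n)} (hJ : IsPruned K X J)
    (hK : (rowSupport X).card ≤ K) : rowSupport X ⊆ J := by
  -- A `K`-element superset of the support has pruning error 0, so the minimum is 0. That `K ≤ n`
  -- follows from the existence of `J`.
  obtain ⟨J', hJ', hc⟩ := Finset.exists_superset_card_eq (n := K) hK
    (by rw [← hJ.1]; exact Finset.card_le_univ J)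
  have h0 : X - restrictRows X J' = 0 := by
    ext i j
    by_cases hi : i ∈ J'
    · simp [restrictRows, hi]
    · simp [restrictRows, hi, row_eq_zero_of_notMem hJ' hi]
  have h1 := hJ.2 J' hc
  rw [h0] at h1
  have h2 : ∑ i, ∑ j, (X - restrictRows X J) i j ^ 2 ≤ 0 := by
    have : frobNorm (0 : Matrix (Fin n) (Fin r) ℝ) = 0 := by simp [frobNorm]
    rw [this] at h1
    exact Real.sqrt_eq_zero'.1 (le_antisymm h1 (Real.sqrt_nonneg _))
  intro i hi
  by_contra hiJ
  refine mem_rowSupport.1 hi (funext fun j => ?_)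
  have h3 : (X - restrictRows X J) i j ^ 2 ≤ 0 :=
    ((Finset.single_le_sum (f := fun j => (X - restrictRows X J) i j ^ 2)
      (fun j _ => sq_nonneg _) (Finset.mem_univ j)).trans
      (Finset.single_le_sum (f := fun i => ∑ j, (X - restrictRows X J) i j ^ 2)
        (fun i _ => Finset.sum_nonneg fun j _ => sq_nonneg _) (Finset.mem_univ i))).trans h2
  have h4 := pow_eq_zero_iff two_ne_zero |>.1 (le_antisymm h3 (sq_nonneg _))
  simpa [restrictRows, hiJ] using h4

theorem output_eq {J : Finset (Fin n)} (hJ : FullColumnRankOn A J) (h : rowSupport X ⊆ J) :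
    output A (A * X) J = X := by
  set AJ : Matrix (Fin m) J ℝ := A.submatrix id (fun j : J => (j : Fin n)) with hAJ
  have hmul : A * X = AJ * X.submatrix (fun j : J => (j : Fin n)) id := by
    ext k j
    rw [Matrix.mul_apply, Matrix.mul_apply]
    refine (Finset.sum_subset (Finset.subset_univ J) fun i _ hi => ?_).symm.trans
      (Finset.sum_coe_sort J (fun i => A k i * X i j)).symm
    rw [row_eq_zero_of_notMem h hi]
    simp
  have hinj : Function.Injective (AJ.transpose * AJ).mulVec := by
    rw [← Matrix.coe_mulVecLin, ← LinearMap.ker_eq_bot, LinearMap.ker_eq_bot']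
    intro v hv
    have hv' : AJ.mulVec v = 0 := by
      have := (Matrix.conjTranspose_mul_self_mulVec_eq_zero AJ v).1
        (by rw [Matrix.conjTranspose_eq_transpose_of_trivial]; exact hv)
      exact this
    refine funext (Fintype.linearIndependent_iff.1 hJ v ?_)
    ext k
    have := congrFun hv' k
    simpa [hAJ, Matrix.mulVec, dotProduct, euclCol, mul_comm] using this
  have hunit : IsUnit (AJ.transpose * AJ).det :=
    (Matrix.isUnit_iff_isUnit_det _).1 (Matrix.mulVec_injective_iff_isUnit.1 hinj)
  ext i j
  by_cases hi : i ∈ J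
  · have e : (AJ.transpose * AJ)⁻¹ * AJ.transpose * (A * X) =
        X.submatrix (fun j : J => (j : Fin n)) id := by
      rw [hmul, Matrix.mul_assoc, ← Matrix.mul_assoc AJ.transpose,
        Matrix.nonsing_inv_mul_cancel_left _ _ hunit]
    simp only [output, hi, dif_pos]
    rw [← hAJ, e]
    rfl
  · simp [output, hi, row_eq_zero_of_notMem h hi]

end SSMP

/-! ### Existence of runs, the counting invariant, and the main theorem. -/

theorem Finset.exists_subset_card_eq_forall_le {α : Type*} [DecidableEq α] (Ω : Finset α)
    (f : α → ℝ) {l : ℕ} (hl : l ≤ Ω.card) :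
    ∃ I ⊆ Ω, I.card = l ∧ ∀ i ∈ I, ∀ j ∈ Ω, j ∉ I → f j ≤ f i := by
  induction l with
  | zero => exact ⟨∅, by simp⟩
  | succ l ih =>
    obtain ⟨I, hI, hc, hle⟩ := ih (by omega)
    have hne : (Ω \ I).Nonempty := by
      rw [← Finset.card_pos, Finset.card_sdiff_of_subset hI]
      omega
    obtain ⟨k, hk, hmax⟩ := Finset.exists_max_image (Ω \ I) f hne
    rw [Finset.mem_sdiff] at hk
    refine ⟨insert k I, Finset.insert_subset hk.1 hI, by rw [Finset.card_insert_of_notMem hk.2, hc],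
      fun i hi j hj hjI => ?_⟩
    rw [Finset.mem_insert, not_or] at hjI
    rcases Finset.mem_insert.1 hi with rfl | hi
    · exact hmax j (Finset.mem_sdiff.2 ⟨hj, hjI.2⟩)
    · exact hle i hi j hj hjI.2

namespace SSMP

variable {m n r : ℕ}

theorem exists_isSelected (A : Matrix (Fin m) (Fin n) ℝ) (R : Matrix (Fin m) (Fin r) ℝ)
    (T : Finset (Fin n)) (L : ℕ) : ∃ I, IsSelected A R T L I := by
  obtain ⟨I, hI, hc, hle⟩ := Finset.exists_subset_card_eq_forall_le (Finset.univ \ T)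
    (score A R T) (min_le_right L (Finset.univ \ T).card)
  exact ⟨I, Finset.disjoint_left.2 fun i hi => (Finset.mem_sdiff.1 (hI hi)).2, hc,
    fun i hi j hjT hjI => hle i hi j (by simp [hjT]) hjI⟩

/-- Iterate fixed choices of selection and minimizer, and stop at the first failure of the loop
condition, which comes by counter `K` at the latest. -/
theorem nonempty_run (A : Matrix (Fin m) (Fin n) ℝ) (Y : Matrix (Fin m) (Fin r) ℝ) (K L : ℕ)
    (ε : ℝ) : Nonempty (Run A Y K L ε) := by
  classical
  choose est hest using exists_isLeastSquares A Y
  choose sel hsel using fun T => exists_isSelected A (Y - A * est T) T L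
  let supp : ℕ → Finset (Fin n) := fun k => (fun T => T ∪ sel T)^[k] ∅
  have hex : ∃ k, ¬ LoopCondition A Y K L ε k (supp k) :=
    ⟨K, fun h => absurd h.1 (not_lt.2 (min_le_left _ _))⟩
  exact ⟨{
    iters := Nat.find hex
    supp := supp
    est := fun k => est (supp k)
    supp_zero := rfl
    selects := fun k _ => ⟨sel (supp k), hsel _, Function.iterate_succ_apply' _ _ _⟩
    estimates := fun k _ => hest _
    continues := fun k hk => not_not.1 (Nat.find_min hex hk)
    stops := Nat.find_spec hex }⟩

variable {A : Matrix (Fin m) (Fin n) ℝ} {X : Matrix (Fin n) (Fin r) ℝ} {K L : ℕ}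

theorem Run.not_rowSupport_subset (run : Run A (A * X) K L 0) {k : ℕ} (hk : k < run.iters) :
    ¬ rowSupport X ⊆ run.supp k := fun h => by
  have h1 := (run.continues k hk).2
  rw [subspaceDist_eq_zero_of_rowSupport_subset h] at h1
  exact lt_irrefl _ h1

/-- Room for one further column within the independence order. Positivity of `c` makes `r - L * (k -
(K - r))` a genuine subtraction when `k > K - r`. -/
theorem card_sdiff_add_card_lt {K L r k c t : ℕ} (hrK : r ≤ K) (hL : 1 ≤ L) (ht : t ≤ L * k)
    (hc : c ≤ (K - r - k) + (r - L * (k - (K - r)))) (hc0 : 0 < c) :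
    c + t + 1 ≤ L * (K - r) + r + 1 := by
  rcases le_total k (K - r) with h | h
  · obtain ⟨e, he⟩ := Nat.exists_eq_add_of_le h
    have h1 : k - (K - r) = 0 := by omega
    rw [h1] at hc
    have h2 : L * (K - r) = L * k + L * e := by rw [he, mul_add]
    have h3 : e ≤ L * e := Nat.le_mul_of_pos_left _ hL
    omega
  · obtain ⟨d, hd⟩ := Nat.exists_eq_add_of_le h
    have h1 : k - (K - r) = d := by omega
    rw [h1] at hc
    have h2 : L * k = L * (K - r) + L * d := by rw [hd, mul_add]
    omega

/-- Room for a whole selection: `c > r` forces `k < K - r`, so a block of `L` is still in reserve.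
-/
theorem card_sdiff_add_card_add_le {K L r k c t : ℕ} (hL : 1 ≤ L) (ht : t ≤ L * k)
    (hc : c ≤ (K - r - k) + (r - L * (k - (K - r)))) (hrc : r < c) :
    c + t + L ≤ L * (K - r) + r + 1 := by
  have hk : k < K - r := by
    by_contra! h
    omega
  obtain ⟨e, he⟩ := Nat.exists_eq_add_of_lt hk
  have h1 : k - (K - r) = 0 := by omega
  rw [h1] at hc
  have h2 : L * (K - r) = L * k + L * e + L := by rw [he, mul_add, mul_add, mul_one]
  have h3 : e ≤ L * e := Nat.le_mul_of_pos_left _ hL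
  omega

/-- The numbers of selected and of missing support indices along a run. -/
theorem Run.card_le (run : Run A (A * X) K L 0) (hA : ∀ j, ‖euclCol A j‖ = 1)
    (hX : AnyNonzeroRowsIndep r X) (hrX : r ≤ (rowSupport X).card)
    (hK : (rowSupport X).card ≤ K) (hL : 1 ≤ L)
    (hind : ∀ J : Finset (Fin n), J.card ≤ L * (K - r) + r + 1 → FullColumnRankOn A J)
    (hrip : r < K → ∃ δ, RIPBound A (L * (K - r) + r + 1) δ ∧ 0 < δ ∧ δ < 1 ∧
      (K * δ ^ 2 < r * (1 - δ) ∨ K * δ ^ 2 < L * ((1 - δ) ^ 2 * (1 - δ ^ 2)))) :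
    ∀ k ≤ run.iters, (run.supp k).card ≤ L * k ∧
      (rowSupport X \ run.supp k).card ≤ (K - r - k) + (r - L * (k - (K - r))) := by
  intro k
  induction k with
  | zero =>
    intro _
    rw [run.supp_zero, Finset.sdiff_empty]
    simp only [Finset.card_empty, Nat.zero_sub, Nat.mul_zero, Nat.sub_zero]
    omega
  | succ k ih =>
    intro hk
    obtain ⟨ht, hc⟩ := ih (by omega)
    obtain ⟨I, hI, hsucc⟩ := run.selects k hk
    have hU := run.estimates k (by omega)
    set T := run.supp k with hT
    have hc0 : 0 < (rowSupport X \ T).card := by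
      rw [Finset.card_pos, Finset.sdiff_nonempty]
      exact run.not_rowSupport_subset hk
    have hIL : I.card ≤ L := hI.2.1.le.trans (min_le_left _ _)
    have e : rowSupport X \ (T ∪ I) = (rowSupport X \ T) \ I := by
      rw [sdiff_sdiff_left, Finset.sup_eq_union]
    rw [hsucc, e]
    refine ⟨?_, ?_⟩
    · have := Finset.card_union_le T I
      rw [mul_add, mul_one]
      omega
    by_cases hr : r < (rowSupport X \ T).card
    · have hkK : k < K - r := by
        by_contra! h
        omega
      obtain ⟨δ, hδ, hδ0, hδ1, hδc⟩ := hrip (by omega)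
      have hnd := hI.not_disjoint_rowSupport hU hδ hδ0 hδ1 hA hX hL hK hr
        (card_sdiff_add_card_add_le hL ht hc hr) hδc
      obtain ⟨i, hiI, hiS⟩ := Finset.not_disjoint_iff.1 hnd
      have hlt : ((rowSupport X \ T) \ I).card < (rowSupport X \ T).card := by
        refine Finset.card_lt_card ⟨Finset.sdiff_subset, fun h => ?_⟩
        have hiT : i ∉ T := Finset.disjoint_left.1 hI.1 hiI
        exact (Finset.mem_sdiff.1 (h (Finset.mem_sdiff.2 ⟨hiS, hiT⟩))).2 hiI
      have h1 : k - (K - r) = 0 := by omega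
      have h2 : k + 1 - (K - r) = 0 := by omega
      rw [h1] at hc
      rw [h2]
      omega
    · have hstep : ((rowSupport X \ T) \ I).card ≤ (rowSupport X \ T).card - L := by
        rcases hI.subset_or_subset hU hind hX hrX (not_lt.1 hr)
          (card_sdiff_add_card_lt (hrX.trans hK) hL ht hc hc0) with h | h
        · rw [Finset.card_sdiff_of_subset h]
          -- Fewer than `L` indices are selected only when all remaining ones are, and then nothing
          -- stays missing.
          rcases hI.subset_or_card_eq with h' | h'
          · have := Finset.card_le_card
              ((Finset.sdiff_subset_sdiff (Finset.subset_univ (rowSupport X)) le_rfl).trans h')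
            omega
          · rw [h']
        · rw [Finset.sdiff_eq_empty_iff_subset.2 h]
          simp
      rcases lt_or_ge k (K - r) with h | h
      · have h2 : k + 1 - (K - r) = 0 := by omega
        rw [h2]
        omega
      · have h1 : k + 1 - (K - r) = (k - (K - r)) + 1 := by omega
        rw [h1, mul_add, mul_one]
        omega

end SSMP

theorem theorem1 {m n r K L : ℕ}
    (A : Matrix (Fin m) (Fin n) ℝ) (X : Matrix (Fin n) (Fin r) ℝ) (Y : Matrix (Fin m) (Fin r) ℝ)
    (hY : Y = A * X)
    (hA : ∀ j, ‖euclCol A j‖ = 1)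
    (hXsparse : (rowSupport X).card ≤ K)
    (hXcols : LinearIndependent ℝ (fun j : Fin r => euclCol X j))
    (hXrows : AnyNonzeroRowsIndep r X)
    (hL1 : 1 ≤ L)
    (hL : (L : ℝ) ≤ min (K : ℝ) ((m : ℝ) / (K : ℝ)))
    (hcond : (r = K ∧ K + 1 ≤ krank A) ∨
      (r < K ∧ HasRIP A (L * (K - r) + r + 1) ∧
        ripConst A (L * (K - r) + r + 1) <
          max (Real.sqrt r / (Real.sqrt ((K : ℝ) + (r : ℝ) / 4) + Real.sqrt ((r : ℝ) / 4)))
            (Real.sqrt L / (Real.sqrt K + 1.15 * Real.sqrt L)))) :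
    Nonempty (SSMP.Run A Y K L 0) ∧
    ∀ run : SSMP.Run A Y K L 0,
      run.iters ≤ K - r + ⌈(r : ℝ) / (L : ℝ)⌉₊ ∧
      rowSupport X ⊆ run.supp run.iters ∧
      (FullColumnRankOn A (run.supp run.iters) ∨ L * ⌈(r : ℝ) / (L : ℝ)⌉₊ ≤ r + 1 →
        run.est run.iters = X ∧
        ∀ J : Finset (Fin n), SSMP.IsPruned K (run.est run.iters) J → SSMP.output A Y J = X) := by
  subst hY
  refine ⟨SSMP.nonempty_run A _ K L 0, fun run => ?_⟩
  have hrX := le_card_rowSupport hXcols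
  have hrK : r ≤ K := hrX.trans hXsparse
  have hLK : (L : ℝ) ≤ K := hL.trans (min_le_left _ _)
  have hL0 : (0 : ℝ) < L := by exact_mod_cast hL1
  have hK0 : (0 : ℝ) < K := hL0.trans_le hLK
  -- From `L ≤ m / K`: the iteration cap is therefore `K`.
  have hKm : K ≤ m / L := by
    rw [Nat.le_div_iff_mul_le hL1]
    have h1 := (le_div_iff₀ hK0).1 (hL.trans (min_le_right _ _))
    rw [mul_comm]
    exact_mod_cast h1
  have hrip : r < K → ∃ δ, RIPBound A (L * (K - r) + r + 1) δ ∧ 0 < δ ∧ δ < 1 ∧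
      (K * δ ^ 2 < r * (1 - δ) ∨ K * δ ^ 2 < L * ((1 - δ) ^ 2 * (1 - δ ^ 2))) := by
    intro hlt
    rcases hcond with h | ⟨-, ⟨δ₀, h0, -, hδ₀⟩, hδ⟩
    · omega
    have hne : {δ : ℝ | 0 ≤ δ ∧ RIPBound A (L * (K - r) + r + 1) δ}.Nonempty := ⟨δ₀, h0.le, hδ₀⟩
    -- An admissible constant below the threshold may be 0; moving strictly up from it gives a
    -- positive `δ`, as the estimates divide by `δ`.
    obtain ⟨δ₁, ⟨h1, hδ₁⟩, hlt₁⟩ := exists_lt_of_csInf_lt hne hδ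
    obtain ⟨δ, h2, h3⟩ := exists_between hlt₁
    have hpos : 0 < δ := h1.trans_lt h2
    refine ⟨δ, hδ₁.mono h2.le, hpos, ?_⟩
    rcases lt_max_iff.1 h3 with h | h
    · have := mul_sq_lt_of_lt_sqrt_div hK0 (Nat.cast_nonneg r) hpos h
      exact ⟨this.1, Or.inl this.2⟩
    · have := mul_sq_lt_of_lt_sqrt_div_add hL0 hLK hpos h
      exact ⟨this.1, Or.inr this.2⟩
  have hind : ∀ J : Finset (Fin n), J.card ≤ L * (K - r) + r + 1 → FullColumnRankOn A J := by
    intro J hJ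
    rcases hcond with ⟨rfl, hkr⟩ | ⟨hlt, -⟩
    · rw [Nat.sub_self, mul_zero, zero_add] at hJ
      exact fullColumnRankOn_of_card_le_krank (hJ.trans hkr)
    · obtain ⟨δ, hδ, -, hδ1, -⟩ := hrip hlt
      exact hδ.fullColumnRankOn hδ1 hJ
  have hinv := run.card_le hA hXrows hrX hXsparse hL1 hind hrip
  have hceil : r ≤ L * ⌈(r : ℝ) / (L : ℝ)⌉₊ := by
    have h1 := (div_le_iff₀ hL0).1 (Nat.le_ceil ((r : ℝ) / (L : ℝ)))
    rw [mul_comm]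
    exact_mod_cast h1
  have hiters : run.iters ≤ K - r + ⌈(r : ℝ) / (L : ℝ)⌉₊ := by
    by_contra! hgt
    have h1 := (hinv _ hgt.le).2
    rw [Nat.add_sub_cancel_left] at h1
    refine run.not_rowSupport_subset hgt ?_
    rw [← Finset.sdiff_eq_empty_iff_subset, ← Finset.card_eq_zero]
    omega
  obtain ⟨ht, hc⟩ := hinv _ le_rfl
  have hsub : rowSupport X ⊆ run.supp run.iters := by
    rcases Nat.eq_zero_or_pos (rowSupport X \ run.supp run.iters).card with h0 | h0
    · exact Finset.sdiff_eq_empty_iff_subset.1 (Finset.card_eq_zero.1 h0)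
    refine SSMP.rowSupport_subset_of_subspaceDist_nonpos (hind _ ?_) ?_
    · rw [← Finset.sdiff_union_self_eq_union]
      have h1 := Finset.card_union_le (rowSupport X \ run.supp run.iters) (run.supp run.iters)
      have h2 := SSMP.card_sdiff_add_card_lt hrK hL1 ht hc h0
      omega
    · by_contra! hdist
      have hge : min K (m / L) ≤ run.iters := by
        by_contra! h
        exact run.stops ⟨h, hdist⟩
      rw [min_eq_left hKm] at hge
      -- If the cap `K` ended the loop, at least `r` iterations followed the first `K - r`, so the
      -- missing count is already 0.
      have h1 : r ≤ L * (run.iters - (K - r)) :=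
        le_trans (by omega) (Nat.le_mul_of_pos_left _ hL1)
      omega
  refine ⟨hiters, hsub, fun hfull => ?_⟩
  -- Without the rank proviso, the final support has at most `L(K - r) + L⌈r/L⌉` indices, which the
  -- alternative hypothesis keeps within the independence order.
  have hrank : FullColumnRankOn A (run.supp run.iters) := by
    refine hfull.elim id fun h => hind _ (ht.trans ((Nat.mul_le_mul_left L hiters).trans ?_))
    rw [mul_add]
    omega
  have hest := (run.estimates _ le_rfl).eq_of_fullColumnRankOn hsub hrank
  refine ⟨hest, fun J hJ => ?_⟩
  rw [hest] at hJ
  refine SSMP.output_eq (hind J ?_) (hJ.rowSupport_subset hXsparse)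
  rw [hJ.1]
  have : K - r ≤ L * (K - r) := Nat.le_mul_of_pos_left _ hL1
  omega
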